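/- Let $n\ge 1$, let $\Omega\subset\mathbb R^n$ be an open convex set, and let $W:\Omega\to\mathbb R$ be of class $C^2$ with positive definite second derivative $W''(x)$ at every $x\in\Omega$. Assume that $\int_\Omega e^{-W(x)}\,dx=1$, and let $\mu$ be the probability measure on $\Omega$ with density $e^{-W}$ with respect to Lebesgue measure. For $\beta>0$ put $$R_{W,\beta}(x)=W''(x)+\frac1\beta\,W'(x)\otimes W'(x),\qquad x\in\Omega,$$ where $W'(x)$ is the gradient of $W$ at $x$ and $v\otimes v$ denotes the $n\times n$ matrix with entries $v_iv_j$. Then for every real $\beta\ge n$ and every smooth ($C^\infty$) function $g:\Omega\to\mathbb R$ with $\int_\Omega g^2\,d\mu<\infty$, $$\operatorname{Var}_\mu(g)\le C_\beta\int_\Omega\langle R_{W,\beta}^{-1}\nabla g,\nabla g\rangle\,d\mu,\qquad C_\beta=\frac{(1+\sqrt{\beta+1})^2}{\beta},$$ where $\operatorname{Var}_\mu(g)=\int g^2\,d\mu-\left(\int g\,d\mu\right)^2$ and the right-hand side may equal $+\infty$. -/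

import Mathlib

open scoped ContDiff

/-- The Hessian matrix `W''(x)`: the entry `(i, j)` is the second derivative of `W` at `x` along
the standard basis vectors `e_i` and `e_j`. -/
noncomputable def hessianMatrix {n : ℕ} (W : EuclideanSpace ℝ (Fin n) → ℝ)
    (x : EuclideanSpace ℝ (Fin n)) : Matrix (Fin n) (Fin n) ℝ :=
  Matrix.of fun i j =>
    fderiv ℝ (fderiv ℝ W) x (EuclideanSpace.single i 1) (EuclideanSpace.single j 1)

/-- The tensor product `v ⊗ v`: the matrix with entries `v_i v_j`. -/
def tensorSquare {n : ℕ} (v : EuclideanSpace ℝ (Fin n)) : Matrix (Fin n) (Fin n) ℝ :=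
  Matrix.of fun i j => v i * v j

/-- The matrix `R_{W,β}(x) = W''(x) + (1/β) W'(x) ⊗ W'(x)`. -/
noncomputable def matrixR {n : ℕ} (W : EuclideanSpace ℝ (Fin n) → ℝ) (β : ℝ)
    (x : EuclideanSpace ℝ (Fin n)) : Matrix (Fin n) (Fin n) ℝ :=
  hessianMatrix W x + (1 / β) • tensorSquare (gradient W x)

/-- The measure concentrated on `Ω` with density `e^{-W}` with respect to Lebesgue measure. -/
noncomputable def gibbsMeasure {n : ℕ} (Ω : Set (EuclideanSpace ℝ (Fin n)))
    (W : EuclideanSpace ℝ (Fin n) → ℝ) : MeasureTheory.Measure (EuclideanSpace ℝ (Fin n)) :=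
  (MeasureTheory.volume.restrict Ω).withDensity fun x => ENNReal.ofReal (Real.exp (-W x))

/-!
Put `V = exp (W / β)`, so that the density `e^{-W}` is `V^(-β)` and `V'' = (V / β) R`; in
particular `V` is strictly convex.

The dimension enters through the Borell–Brascamp–Lieb inequality at the critical exponent `-1/n`:
if at every midpoint `h` is at least the power mean of exponent `-1/n` of the values of `f` and `g`,
then `∫ h ≥ min (∫ f, ∫ g)` (`min_lintegral_le_of_negPowerMean_le`). It is proved by induction on
the dimension; each integration in one variable changes the exponent `-1/(m+1)` into `-1/m`, by the
Brunn–Minkowski inequality for the superlevel sets on the line and by Hölder's inequality.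

On a compact convex set `K ⊆ Ω` this is applied to the densities `(V - t G)^(-β)` and
`(V + t G)^(-β)` with `G = g V`. The average of `V - t G` at `z - h` and `V + t G` at `z + h` is
`V + ½ V''(h, h) + t G'(h) + o(t²) ≥ V - t² Q / 2 + o(t²)` uniformly on `K`, where `Q` is the
squared norm of `G'` dual to `V''` (`exists_le_average_of_sq_fderiv_le`). As `β ≥ n`, the
hypothesis of the Borell–Brascamp–Lieb inequality holds for the density `(V - t² Q / 2)^(-β)`. If
`g` has mean zero, the comparison of the terms of order `t²` gives
`(β + 1) ∫ g² V^(-β) ≤ ∫ (Q / V) V^(-β)` over `K` (`integral_sq_mul_rpow_neg_le`).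

Since `V'` has squared dual norm at most `V`, Young's inequality bounds `Q / V` by
`(1 + 1/s) β ⟨R⁻¹ ∇g, ∇g⟩ + (1 + s) g²`, and the choice `s = √(β + 1) - 1` gives the constant
`(1 + √(β + 1))² / β`. Only the first two derivatives of `W` on `K` are used and nothing is required
at the boundary, so exhausting `Ω` by compact convex sets finishes the proof.
-/

open MeasureTheory Set Filter Topology ENNReal

/-! ### Power means of negative exponent -/

/-- The power mean with equal weights and exponent `-1/m` of `a, b ∈ [0, ∞]`; for `m = 0` the
exponent is `-∞` and the mean is the minimum. It vanishes as soon as one of `a, b` does. -/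
noncomputable def negPowerMean (m : ℕ) (a b : ℝ≥0∞) : ℝ≥0∞ :=
  if m = 0 then min a b else (((a⁻¹ ^ (m : ℝ)⁻¹ + b⁻¹ ^ (m : ℝ)⁻¹) / 2) ^ m)⁻¹

theorem negPowerMean_zero (a b : ℝ≥0∞) : negPowerMean 0 a b = min a b := by
  simp [negPowerMean]

theorem negPowerMean_succ (m : ℕ) (a b : ℝ≥0∞) :
    negPowerMean (m + 1) a b =
      (((a⁻¹ ^ ((m + 1 : ℕ) : ℝ)⁻¹ + b⁻¹ ^ ((m + 1 : ℕ) : ℝ)⁻¹) / 2) ^ (m + 1))⁻¹ := by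
  simp [negPowerMean]

theorem negPowerMean_mono (m : ℕ) {a b a' b' : ℝ≥0∞} (ha : a ≤ a') (hb : b ≤ b') :
    negPowerMean m a b ≤ negPowerMean m a' b' := by
  unfold negPowerMean
  split_ifs
  · exact min_le_min ha hb
  · gcongr

theorem negPowerMean_zero_left (m : ℕ) (b : ℝ≥0∞) : negPowerMean m 0 b = 0 := by
  rcases m with _ | m
  · simp [negPowerMean_zero]
  · have : (0 : ℝ) < ((m + 1 : ℕ) : ℝ)⁻¹ := by positivity
    rw [negPowerMean_succ, ENNReal.inv_zero, ENNReal.top_rpow_of_pos this, top_add,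
      ENNReal.top_div_of_ne_top (by simp)]
    simp

theorem negPowerMean_comm (m : ℕ) (a b : ℝ≥0∞) : negPowerMean m a b = negPowerMean m b a := by
  unfold negPowerMean
  rw [min_comm, add_comm]

theorem negPowerMean_zero_right (m : ℕ) (a : ℝ≥0∞) : negPowerMean m a 0 = 0 := by
  rw [negPowerMean_comm, negPowerMean_zero_left]

theorem negPowerMean_pos (m : ℕ) {a b : ℝ≥0∞} (ha : a ≠ 0) (hb : b ≠ 0) :
    negPowerMean m a b ≠ 0 := by
  rcases m with _ | m
  · simp [negPowerMean_zero, ha, hb, min_eq_iff]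
  · have : (0 : ℝ) ≤ ((m + 1 : ℕ) : ℝ)⁻¹ := by positivity
    rw [negPowerMean_succ, ENNReal.inv_ne_zero]
    refine ENNReal.pow_ne_top (ENNReal.div_ne_top (ENNReal.add_ne_top.2 ⟨?_, ?_⟩) (by simp)) <;>
    exact ENNReal.rpow_ne_top_of_nonneg this (by simpa)

theorem negPowerMean_ne_top (m : ℕ) {a : ℝ≥0∞} (ha : a ≠ ⊤) (b : ℝ≥0∞) :
    negPowerMean m a b ≠ ⊤ := by
  rcases m with _ | m
  · simp [negPowerMean_zero, ha]
  · have : (0 : ℝ) ≤ ((m + 1 : ℕ) : ℝ)⁻¹ := by positivity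
    rw [negPowerMean_succ, ENNReal.inv_ne_top]
    refine pow_ne_zero _ (ENNReal.div_ne_zero.2 ⟨?_, by simp⟩)
    exact fun h => (ENNReal.rpow_pos_of_nonneg (ENNReal.inv_pos.2 ha) this).ne' (add_eq_zero.1 h).1

theorem mul_negPowerMean_le (m : ℕ) {c : ℝ≥0∞} (hc : c ≠ ⊤) (a b : ℝ≥0∞) :
    c * negPowerMean m a b ≤ negPowerMean m (c * a) (c * b) := by
  rcases eq_or_ne c 0 with rfl | hc0
  · simp
  rcases m with _ | m
  · simp only [negPowerMean_zero, le_min_iff]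
    exact ⟨by gcongr; exact min_le_left _ _, by gcongr; exact min_le_right _ _⟩
  · have hr : (0 : ℝ) ≤ ((m + 1 : ℕ) : ℝ)⁻¹ := by positivity
    simp only [negPowerMean_succ]
    rw [ENNReal.mul_inv (.inl hc0) (.inl hc), ENNReal.mul_inv (.inl hc0) (.inl hc),
      ENNReal.mul_rpow_of_nonneg _ _ hr, ENNReal.mul_rpow_of_nonneg _ _ hr, ← mul_add,
      mul_div_assoc, mul_pow, ← ENNReal.rpow_natCast (c⁻¹ ^ _), ← ENNReal.rpow_mul,
      inv_mul_cancel₀ (by positivity), ENNReal.rpow_one,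
      ENNReal.mul_inv (.inl (by simpa)) (.inl (by simpa)), inv_inv]

theorem continuous_negPowerMean (m : ℕ) :
    Continuous fun p : ℝ≥0∞ × ℝ≥0∞ => negPowerMean m p.1 p.2 := by
  rcases m with _ | m
  · simp only [negPowerMean_zero]
    fun_prop
  · simp only [negPowerMean_succ]
    refine continuous_inv.comp ((ENNReal.continuous_pow _).comp
      ((ENNReal.continuous_div_const 2 (by simp)).comp ?_))
    exact ((ENNReal.continuous_rpow_const.comp (continuous_inv.comp continuous_fst))).add
      ((ENNReal.continuous_rpow_const.comp (continuous_inv.comp continuous_snd)))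

/-- Hölder's inequality for averages of two terms. -/
theorem pow_average_le_mul (m : ℕ) {A B u v : ℝ≥0∞} (hu : u ≠ 0) (hu' : u ≠ ⊤) (hv : v ≠ 0)
    (hv' : v ≠ ⊤) :
    ((A ^ ((m + 2 : ℕ) : ℝ)⁻¹ + B ^ ((m + 2 : ℕ) : ℝ)⁻¹) / 2) ^ (m + 2) ≤
      (u + v) / 2 * (((A * u⁻¹) ^ ((m + 1 : ℕ) : ℝ)⁻¹ + (B * v⁻¹) ^ ((m + 1 : ℕ) : ℝ)⁻¹) / 2) ^
        (m + 1) := by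
  set M : ℝ := ((m + 2 : ℕ) : ℝ) with hM
  set q : ℝ := M / ((m + 1 : ℕ) : ℝ) with hq
  have hM0 : 0 < M := by positivity
  have hm0 : (0 : ℝ) < ((m + 1 : ℕ) : ℝ) := by positivity
  have hpq : M.HolderConjugate q := by
    rw [Real.holderConjugate_iff]
    refine ⟨by rw [hM]; push_cast; linarith [(Nat.cast_nonneg m : (0 : ℝ) ≤ m)], ?_⟩
    rw [hq, hM]
    push_cast
    field_simp
    ring
  have hsplit : ∀ {X w : ℝ≥0∞}, w ≠ 0 → w ≠ ⊤ → X ^ M⁻¹ = w ^ M⁻¹ * (X * w⁻¹) ^ M⁻¹ := by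
    intro X w h0 h1
    rw [← ENNReal.mul_rpow_of_nonneg _ _ (by positivity), mul_comm X, ← mul_assoc,
      ENNReal.mul_inv_cancel h0 h1, one_mul]
  have hH := ENNReal.inner_le_Lp_mul_Lq (Finset.univ : Finset (Fin 2)) ![u ^ M⁻¹, v ^ M⁻¹]
    ![(A * u⁻¹) ^ M⁻¹, (B * v⁻¹) ^ M⁻¹] hpq
  simp only [Fin.sum_univ_two, Matrix.cons_val_zero, Matrix.cons_val_one,
    ← ENNReal.rpow_mul, ← hsplit hu hu', ← hsplit hv hv', inv_mul_cancel₀ hM0.ne',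
    ENNReal.rpow_one, one_div] at hH
  have e1 : M⁻¹ * q = ((m + 1 : ℕ) : ℝ)⁻¹ := by rw [hq]; field_simp
  rw [e1] at hH
  set S := (A * u⁻¹) ^ ((m + 1 : ℕ) : ℝ)⁻¹ + (B * v⁻¹) ^ ((m + 1 : ℕ) : ℝ)⁻¹ with hS
  calc ((A ^ M⁻¹ + B ^ M⁻¹) / 2) ^ (m + 2)
      ≤ ((u + v) ^ M⁻¹ * S ^ q⁻¹ / 2) ^ (m + 2) := by gcongr
    _ = (u + v) * S ^ (m + 1) / 2 ^ (m + 2) := by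
        rw [div_eq_mul_inv, mul_pow, mul_pow, ← ENNReal.rpow_natCast (_ ^ M⁻¹),
          ← ENNReal.rpow_natCast (_ ^ q⁻¹), ← ENNReal.rpow_mul, ← ENNReal.rpow_mul, ← hM,
          inv_mul_cancel₀ hM0.ne', ENNReal.rpow_one, div_eq_mul_inv ((u + v) * _), ENNReal.inv_pow]
        congr 2
        rw [hq, inv_div, div_mul_cancel₀ _ hM0.ne', ENNReal.rpow_natCast]
    _ = (u + v) / 2 * (S / 2) ^ (m + 1) := by
        simp only [div_eq_mul_inv]
        rw [mul_pow, ← ENNReal.inv_pow, pow_succ 2 (m + 1),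
          ENNReal.mul_inv (.inl (by simp)) (.inl (by simp))]
        ring

/-- The generalized Hölder inequality `M_{-1/(m+1)}(a, b) M_1(u, v) ≥ M_{-1/m}(a u, b v)`. -/
theorem negPowerMean_mul_le (m : ℕ) {a b : ℝ≥0∞} (ha : a ≠ 0) (ha' : a ≠ ⊤) (hb : b ≠ 0)
    (hb' : b ≠ ⊤) (u v : ℝ≥0∞) :
    negPowerMean m (a * u) (b * v) ≤ negPowerMean (m + 1) a b * ((u + v) / 2) := by
  rcases eq_or_ne u 0 with rfl | hu
  · simp [negPowerMean_zero_left]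
  rcases eq_or_ne v 0 with rfl | hv
  · simp [negPowerMean_zero_right]
  have hpos := negPowerMean_pos (m + 1) ha hb
  rcases eq_or_ne u ⊤ with rfl | hu'
  · simp [ENNReal.top_div_of_ne_top, ENNReal.mul_top hpos]
  rcases eq_or_ne v ⊤ with rfl | hv'
  · simp [ENNReal.top_div_of_ne_top, ENNReal.mul_top hpos]
  set w := (u + v) / 2 with hw
  have hw0 : w ≠ 0 := ENNReal.div_ne_zero.2 ⟨by simp [hu], by simp⟩
  have hw' : w ≠ ⊤ := ENNReal.div_ne_top (ENNReal.add_ne_top.2 ⟨hu', hv'⟩) (by simp)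
  -- inverting both sides turns the claim into Hölder's inequality
  rw [← ENNReal.inv_le_inv, ENNReal.mul_inv (.inr hw') (.inr hw0), ← div_eq_mul_inv]
  refine ENNReal.div_le_of_le_mul' ?_
  rw [negPowerMean_succ, inv_inv]
  rcases m with _ | m
  · have hh : ∀ {x y : ℝ≥0∞}, x ≠ 0 → x ≠ ⊤ → y ≠ 0 → y ≠ ⊤ → x⁻¹ = y * (x * y)⁻¹ := by
      intro x y h1 h2 h3 h4
      rw [ENNReal.mul_inv (.inl h1) (.inl h2), mul_comm x⁻¹, ← mul_assoc,
        ENNReal.mul_inv_cancel h3 h4, one_mul]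
    simp only [negPowerMean_zero, zero_add, Nat.cast_one, inv_one, ENNReal.rpow_one, pow_one]
    rw [hw, div_eq_mul_inv, div_eq_mul_inv, mul_right_comm]
    gcongr
    rw [hh ha ha' hu hu', hh hb hb' hv hv', add_mul]
    gcongr
    · exact min_le_left _ _
    · exact min_le_right _ _
  · rw [negPowerMean_succ, inv_inv, ENNReal.mul_inv (.inl ha) (.inl ha'),
      ENNReal.mul_inv (.inl hb) (.inl hb')]
    exact pow_average_le_mul m hu hu' hv hv'

/-! ### Borell–Brascamp–Lieb inequality for midpoints -/

theorem volume_add_volume_le_of_isCompact {A B C : Set ℝ} (hA : IsCompact A) (hB : IsCompact B)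
    (hA0 : A.Nonempty) (hB0 : B.Nonempty) (h : ∀ a ∈ A, ∀ b ∈ B, (a + b) / 2 ∈ C) :
    volume A + volume B ≤ 2 * volume C := by
  obtain ⟨a₀, ha₀, hmax⟩ := hA.exists_isGreatest hA0
  obtain ⟨b₀, hb₀, hmin⟩ := hB.exists_isLeast hB0
  have hvol : ∀ (S : Set ℝ) (c : ℝ), volume {z : ℝ | 2 * z - c ∈ S} = volume S / 2 := by
    intro S c
    have : {z : ℝ | 2 * z - c ∈ S} = (2 * ·) ⁻¹' ((· + (-c)) ⁻¹' S) := by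
      ext z; simp [sub_eq_add_neg]
    rw [this, Real.volume_preimage_mul_left two_ne_zero, measure_preimage_add_right,
      abs_of_pos (by norm_num), ENNReal.ofReal_inv_of_pos two_pos, mul_comm,
      ENNReal.ofReal_ofNat, div_eq_mul_inv]
  have hsub : {z : ℝ | 2 * z - b₀ ∈ A} ∪ {z : ℝ | 2 * z - a₀ ∈ B} ⊆ C := by
    rintro z (hz | hz)
    · simpa using h _ hz _ hb₀
    · simpa using h _ ha₀ _ hz
  have hdisj : AEDisjoint volume {z : ℝ | 2 * z - b₀ ∈ A} {z : ℝ | 2 * z - a₀ ∈ B} := by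
    refine measure_mono_null (t := {(a₀ + b₀) / 2}) ?_ (by simp)
    rintro z ⟨h1, h2⟩
    have h3 := hmax h1
    have h4 := hmin h2
    rw [mem_singleton_iff]
    linarith
  have hmeas : NullMeasurableSet {z : ℝ | 2 * z - a₀ ∈ B} volume :=
    (hB.isClosed.preimage (by fun_prop : Continuous fun z : ℝ => 2 * z - a₀)).measurableSet
      |>.nullMeasurableSet
  have := measure_mono (μ := volume) hsub
  rw [measure_union₀ hmeas hdisj, hvol, hvol, ← ENNReal.add_div] at this
  rw [mul_comm]
  exact (ENNReal.div_le_iff_le_mul (by simp) (by simp)).1 this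

/-- The Brunn–Minkowski inequality on the line, for midpoints. -/
theorem volume_add_volume_le {A B C : Set ℝ} (hA : MeasurableSet A) (hB : MeasurableSet B)
    (hA0 : A.Nonempty) (hB0 : B.Nonempty) (h : ∀ a ∈ A, ∀ b ∈ B, (a + b) / 2 ∈ C) :
    volume A + volume B ≤ 2 * volume C := by
  rw [hA.measure_eq_iSup_isCompact, hB.measure_eq_iSup_isCompact]
  simp only [iSup_and']
  refine ENNReal.biSup_add_biSup_le' ⟨∅, by simp⟩ ⟨∅, by simp⟩ ?_
  rintro K ⟨hKA, hK⟩ L ⟨hLB, hL⟩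
  obtain ⟨a, ha⟩ := hA0
  obtain ⟨b, hb⟩ := hB0
  refine le_trans ?_ (volume_add_volume_le_of_isCompact (hK.insert a) (hL.insert b)
    (insert_nonempty _ _) (insert_nonempty _ _) ?_ : _ ≤ 2 * volume C)
  · gcongr <;> exact subset_insert _ _
  · intro x hx y hy
    exact h x (insert_subset ha hKA hx) y (insert_subset hb hLB hy)

/-- If `f` and `g` have supremum `1` and `h` dominates the minimum of their values at midpoints,
then each superlevel set of `h` of level `s < 1` contains the midpoints of those of `f` and `g`. -/
theorem lintegral_add_le_of_iSup_eq_one {f g h : ℝ → ℝ≥0∞} (hf : Measurable f)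
    (hg : Measurable g) (hh : Measurable h) (hf1 : ⨆ x, f x = 1) (hg1 : ⨆ x, g x = 1)
    (hfgh : ∀ x y, min (f x) (g y) ≤ h ((x + y) / 2)) :
    (∫⁻ x, f x) + ∫⁻ x, g x ≤ 2 * ∫⁻ x, h x := by
  have layer : ∀ {k : ℝ → ℝ≥0∞}, Measurable k → (∀ x, k x ≤ 1) →
      ∫⁻ x, k x = ∫⁻ t in Ioo (0 : ℝ) 1, volume {x | ENNReal.ofReal t < k x} := by
    intro k hk hk1
    have hfin : ∀ x, k x ≠ ⊤ := fun x => ne_top_of_le_ne_top one_ne_top (hk1 x)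
    have e := lintegral_eq_lintegral_meas_lt volume (f := fun x => (k x).toReal)
      (ae_of_all _ fun x => toReal_nonneg) hk.ennreal_toReal.aemeasurable
    simp only [ofReal_toReal (hfin _)] at e
    rw [e, ← Ioc_union_Ioi_eq_Ioi (zero_le_one' ℝ), lintegral_union measurableSet_Ioi
      (Ioc_disjoint_Ioi le_rfl), setLIntegral_congr Ioo_ae_eq_Ioc.symm]
    have : ∫⁻ t in Ioi (1 : ℝ), volume {x | t < (k x).toReal} = 0 := by
      refine (setLIntegral_congr_fun measurableSet_Ioi ?_).trans lintegral_zero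
      intro t ht
      have : {x | t < (k x).toReal} = ∅ := by
        ext x
        simp only [mem_ofPred_eq, mem_empty_iff_false, iff_false, not_lt]
        exact (toReal_mono one_ne_top (hk1 x)).trans (by simpa using le_of_lt ht)
      simp [this]
    rw [this, add_zero]
    refine setLIntegral_congr_fun measurableSet_Ioo ?_
    intro t ht
    refine congrArg volume (Set.ext fun x => ?_)
    exact (ofReal_lt_iff_lt_toReal ht.1.le (hfin x)).symm
  have hfle : ∀ x, f x ≤ 1 := fun x => hf1 ▸ le_iSup f x
  have hgle : ∀ x, g x ≤ 1 := fun x => hg1 ▸ le_iSup g x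
  have hmeas : ∀ {k : ℝ → ℝ≥0∞}, Measurable k → ∀ s, MeasurableSet {x | s < k x} :=
    fun hk s => measurableSet_lt measurable_const hk
  have hanti : ∀ k : ℝ → ℝ≥0∞, Measurable fun t : ℝ => volume {x | ENNReal.ofReal t < k x} := by
    intro k
    refine Antitone.measurable fun s t hst => measure_mono fun x hx => ?_
    exact lt_of_le_of_lt (ofReal_le_ofReal hst) hx
  calc (∫⁻ x, f x) + ∫⁻ x, g x
      = ∫⁻ t in Ioo (0 : ℝ) 1,
        (volume {x | ENNReal.ofReal t < f x} + volume {x | ENNReal.ofReal t < g x}) := by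
        rw [layer hf hfle, layer hg hgle, lintegral_add_left (hanti f)]
    _ ≤ ∫⁻ t in Ioo (0 : ℝ) 1, 2 * volume {x | ENNReal.ofReal t < min (h x) 1} := by
        refine setLIntegral_mono ((hanti _).const_mul 2) fun t ht => ?_
        have ht1 : ENNReal.ofReal t < 1 := by simpa using ht.2
        refine volume_add_volume_le (hmeas hf _) (hmeas hg _) ?_ ?_ ?_
        · exact lt_iSup_iff.1 (hf1.symm ▸ ht1)
        · exact lt_iSup_iff.1 (hg1.symm ▸ ht1)
        · intro a ha b hb
          exact lt_min ((lt_min ha hb).trans_le (hfgh a b)) ht1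
    _ = 2 * ∫⁻ x, min (h x) 1 := by
        rw [lintegral_const_mul _ (hanti _), layer (hh.min measurable_const)
          fun x => min_le_right _ _]
    _ ≤ 2 * ∫⁻ x, h x := by gcongr; exact min_le_left _ _

theorem negPowerMean_lintegral_le_of_bounded (m : ℕ) {f g h : ℝ → ℝ≥0∞} (hf : Measurable f)
    (hg : Measurable g) (hh : Measurable h) (hfb : ⨆ x, f x ≠ ⊤) (hgb : ⨆ x, g x ≠ ⊤)
    (hfgh : ∀ x y, negPowerMean (m + 1) (f x) (g y) ≤ h ((x + y) / 2)) :
    negPowerMean m (∫⁻ x, f x) (∫⁻ x, g x) ≤ ∫⁻ x, h x := by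
  set a := ⨆ x, f x with ha
  set b := ⨆ x, g x with hb
  rcases eq_or_ne a 0 with ha0 | ha0
  · have : ∀ x, f x = 0 := fun x => le_antisymm (ha0 ▸ le_iSup f x) zero_le
    simp [this, negPowerMean_zero_left]
  rcases eq_or_ne b 0 with hb0 | hb0
  · have : ∀ x, g x = 0 := fun x => le_antisymm (hb0 ▸ le_iSup g x) zero_le
    simp [this, negPowerMean_zero_right]
  set c := negPowerMean (m + 1) a b with hc
  have hc0 : c ≠ 0 := negPowerMean_pos _ ha0 hb0
  have hc' : c ≠ ⊤ := negPowerMean_ne_top _ hfb b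
  have key := lintegral_add_le_of_iSup_eq_one (f := fun x => a⁻¹ * f x) (g := fun x => b⁻¹ * g x)
    (h := fun x => c⁻¹ * h x) (hf.const_mul _) (hg.const_mul _) (hh.const_mul _)
    (by rw [← ENNReal.mul_iSup, ← ha, ENNReal.inv_mul_cancel ha0 hfb])
    (by rw [← ENNReal.mul_iSup, ← hb, ENNReal.inv_mul_cancel hb0 hgb]) ?_
  · rw [lintegral_const_mul _ hf, lintegral_const_mul _ hg, lintegral_const_mul _ hh] at key
    have e : ∀ {p : ℝ≥0∞} (I : ℝ≥0∞), p ≠ 0 → p ≠ ⊤ → I = p * (p⁻¹ * I) := by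
      intro p I h1 h2
      rw [← mul_assoc, ENNReal.mul_inv_cancel h1 h2, one_mul]
    calc negPowerMean m (∫⁻ x, f x) (∫⁻ x, g x)
        = negPowerMean m (a * (a⁻¹ * ∫⁻ x, f x)) (b * (b⁻¹ * ∫⁻ x, g x)) := by
          rw [← e _ ha0 hfb, ← e _ hb0 hgb]
      _ ≤ c * ((a⁻¹ * (∫⁻ x, f x) + b⁻¹ * ∫⁻ x, g x) / 2) :=
          negPowerMean_mul_le m ha0 hfb hb0 hgb _ _
      _ ≤ c * (c⁻¹ * ∫⁻ x, h x) := by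
          gcongr
          exact ENNReal.div_le_of_le_mul' key
      _ = ∫⁻ x, h x := (e _ hc0 hc').symm
  · intro x y
    set s := min (a⁻¹ * f x) (b⁻¹ * g y) with hs
    have hle : ∀ {p r : ℝ≥0∞}, p ≠ 0 → p ≠ ⊤ → s ≤ p⁻¹ * r → s * p ≤ r := by
      intro p r h1 h2 h3
      calc s * p ≤ p⁻¹ * r * p := by gcongr
        _ = r := by rw [mul_comm, ← mul_assoc, ENNReal.mul_inv_cancel h1 h2, one_mul]
    have hs1 : s ≠ ⊤ := by
      refine ne_top_of_le_ne_top ?_ (min_le_left _ _)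
      exact ENNReal.mul_ne_top (by simpa) (ne_top_of_le_ne_top hfb (le_iSup f x))
    have h1 : s * c ≤ h ((x + y) / 2) :=
      ((mul_negPowerMean_le (m + 1) hs1 a b).trans (negPowerMean_mono _
        (hle ha0 hfb (min_le_left _ _)) (hle hb0 hgb (min_le_right _ _)))).trans (hfgh x y)
    calc s = c⁻¹ * (s * c) := by
          rw [mul_comm s, ← mul_assoc, ENNReal.inv_mul_cancel hc0 hc', one_mul]
      _ ≤ c⁻¹ * h ((x + y) / 2) := by gcongr

theorem tendsto_lintegral_min_natCast {k : ℝ → ℝ≥0∞} (hk : Measurable k) :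
    Tendsto (fun N : ℕ => ∫⁻ x, min (k x) N) atTop (𝓝 (∫⁻ x, k x)) := by
  refine lintegral_tendsto_of_tendsto_of_monotone (fun N => (hk.min measurable_const).aemeasurable)
    (ae_of_all _ fun x N M hNM => ?_) (ae_of_all _ fun x => ?_)
  · exact min_le_min le_rfl (by exact_mod_cast hNM)
  · simpa using (tendsto_const_nhds (x := k x)).min ENNReal.tendsto_nat_nhds_top

/-- The one-dimensional Borell–Brascamp–Lieb inequality for midpoints: integration in one variable
turns the exponent `-1/(m+1)` into `-1/m`. -/
theorem negPowerMean_lintegral_le (m : ℕ) {f g h : ℝ → ℝ≥0∞} (hf : Measurable f)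
    (hg : Measurable g) (hh : Measurable h)
    (hfgh : ∀ x y, negPowerMean (m + 1) (f x) (g y) ≤ h ((x + y) / 2)) :
    negPowerMean m (∫⁻ x, f x) (∫⁻ x, g x) ≤ ∫⁻ x, h x := by
  have hlim : Tendsto (fun N : ℕ => negPowerMean m (∫⁻ x, min (f x) N) (∫⁻ x, min (g x) N)) atTop
      (𝓝 (negPowerMean m (∫⁻ x, f x) (∫⁻ x, g x))) :=
    Tendsto.comp (f := fun N : ℕ => ((∫⁻ x, min (f x) N), (∫⁻ x, min (g x) N)))
      (g := fun p : ℝ≥0∞ × ℝ≥0∞ => negPowerMean m p.1 p.2)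
      ((continuous_negPowerMean m).tendsto ((∫⁻ x, f x), (∫⁻ x, g x)))
      ((tendsto_lintegral_min_natCast hf).prodMk_nhds (tendsto_lintegral_min_natCast hg))
  have hbdd : ∀ (k : ℝ → ℝ≥0∞) (N : ℕ), (⨆ x, min (k x) N) ≠ ⊤ := fun k N =>
    ne_top_of_le_ne_top (natCast_ne_top N) (iSup_le fun x => min_le_right _ _)
  refine le_of_tendsto' hlim fun N => ?_
  exact negPowerMean_lintegral_le_of_bounded m (hf.min measurable_const)
    (hg.min measurable_const) hh (hbdd f N) (hbdd g N) fun x y =>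
      (negPowerMean_mono _ (min_le_left _ _) (min_le_left _ _)).trans (hfgh x y)

theorem lintegral_pi_succ {k : ℕ} {f : (Fin (k + 1) → ℝ) → ℝ≥0∞} (hf : Measurable f) :
    ∫⁻ x, f x = ∫⁻ t : ℝ, ∫⁻ y : Fin k → ℝ, f (Fin.cons t y) := by
  have hmp := (volume_preserving_piFinSuccAbove (fun _ : Fin (k + 1) => ℝ) 0).symm
  rw [← hmp.lintegral_comp hf, Measure.volume_eq_prod, lintegral_prod]
  · simp [MeasurableEquiv.piFinSuccAbove_symm_apply, Fin.insertNthEquiv]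
  · exact (hf.comp (MeasurableEquiv.measurable _)).aemeasurable

/-- The Borell–Brascamp–Lieb inequality for midpoints in `ℝᵏ`, by induction on `k`: the marginals
of the fibres satisfy the hypothesis on the line. -/
theorem negPowerMean_lintegral_pi_le (k : ℕ) : ∀ (m : ℕ) {f g h : (Fin k → ℝ) → ℝ≥0∞},
    Measurable f → Measurable g → Measurable h →
    (∀ x y, negPowerMean (m + k) (f x) (g y) ≤ h ((1 / 2 : ℝ) • (x + y))) →
    negPowerMean m (∫⁻ x, f x) (∫⁻ x, g x) ≤ ∫⁻ x, h x := by
  induction k with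
  | zero =>
    intro m f g h hf hg hh hfgh
    have hvol : volume (univ : Set (Fin 0 → ℝ)) = 1 := by simp [volume_pi]
    rw [lintegral_unique, lintegral_unique, lintegral_unique, hvol, mul_one, mul_one, mul_one]
    have key : ∀ p q r : Fin 0 → ℝ, negPowerMean m (f p) (g q) ≤ h r := fun p q r =>
      Subsingleton.elim ((1 / 2 : ℝ) • (p + q)) r ▸ hfgh p q
    exact key _ _ _
  | succ k ih =>
    intro m f g h hf hg hh hfgh
    rw [lintegral_pi_succ hf, lintegral_pi_succ hg, lintegral_pi_succ hh]
    have hcons : Measurable fun p : ℝ × (Fin k → ℝ) => (Fin.cons p.1 p.2 : Fin (k + 1) → ℝ) :=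
      measurable_pi_lambda _ fun i => by
        refine Fin.cases ?_ (fun j => ?_) i
        · simpa using measurable_fst
        · simpa using measurable_snd.eval
    have hmarg : ∀ {F : (Fin (k + 1) → ℝ) → ℝ≥0∞}, Measurable F →
        Measurable fun t : ℝ => ∫⁻ y : Fin k → ℝ, F (Fin.cons t y) :=
      fun hF => (hF.comp hcons).lintegral_prod_right'
    refine negPowerMean_lintegral_le m (hmarg hf) (hmarg hg) (hmarg hh) fun s t => ?_
    refine ih (m + 1) (hf.comp (hcons.comp measurable_prodMk_left))
      (hg.comp (hcons.comp measurable_prodMk_left))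
      (hh.comp (hcons.comp measurable_prodMk_left)) fun x y => ?_
    have := hfgh (Fin.cons s x) (Fin.cons t y)
    have e : (1 / 2 : ℝ) • ((Fin.cons s x : Fin (k + 1) → ℝ) + Fin.cons t y) =
        Fin.cons ((s + t) / 2) ((1 / 2 : ℝ) • (x + y)) := by
      ext i
      refine Fin.cases ?_ (fun j => ?_) i
      · simp; ring
      · simp [mul_add]
    rw [e] at this
    rwa [show m + 1 + k = m + (k + 1) by ring]

/-- The Borell–Brascamp–Lieb inequality for midpoints in `ℝⁿ`, at the critical exponent `-1/n`. -/
theorem min_lintegral_le_of_negPowerMean_le {n : ℕ} {f g h : EuclideanSpace ℝ (Fin n) → ℝ≥0∞}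
    (hf : Measurable f) (hg : Measurable g) (hh : Measurable h)
    (hfgh : ∀ x y, negPowerMean n (f x) (g y) ≤ h ((1 / 2 : ℝ) • (x + y))) :
    min (∫⁻ x, f x) (∫⁻ x, g x) ≤ ∫⁻ x, h x := by
  have hmp := PiLp.volume_preserving_toLp (Fin n)
  rw [← hmp.lintegral_comp hf, ← hmp.lintegral_comp hg, ← hmp.lintegral_comp hh,
    ← negPowerMean_zero]
  refine negPowerMean_lintegral_pi_le n 0 (hf.comp hmp.measurable) (hg.comp hmp.measurable)
    (hh.comp hmp.measurable) fun x y => ?_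
  rw [zero_add]
  exact hfgh _ _

/-! ### Second-order expansion at midpoints -/

theorem IsCompact.exists_norm_sub_le_of_continuousOn {E F : Type*} [NormedAddCommGroup E]
    [NormedAddCommGroup F] {K : Set E} (hK : IsCompact K) {f : E → F} (hf : ContinuousOn f K) {η : ℝ} (hη : 0 < η) :
    ∃ δ > 0, ∀ x ∈ K, ∀ y ∈ K, ‖x - y‖ ≤ δ → ‖f x - f y‖ ≤ η := by
  simpa only [dist_eq_norm] using
    Metric.uniformContinuousOn_iff_le.1 (hK.uniformContinuousOn_of_continuous hf) η hη

section Midpoint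

variable {E : Type*} [NormedAddCommGroup E] [NormedSpace ℝ E]

theorem ContDiffOn.hasFDerivAt_fderiv {Ω : Set E} (hΩ : IsOpen Ω) {V : E → ℝ}
    (hV : ContDiffOn ℝ 2 V Ω) {z : E} (hz : z ∈ Ω) :
    HasFDerivAt (fderiv ℝ V) (fderiv ℝ (fderiv ℝ V) z) z :=
  (((hV.fderiv_of_isOpen hΩ (m := 1) (by norm_num)).differentiableOn one_ne_zero).differentiableAt
    (hΩ.mem_nhds hz)).hasFDerivAt

theorem ContDiffOn.continuousOn_fderiv_fderiv {Ω : Set E} (hΩ : IsOpen Ω) {V : E → ℝ}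
    (hV : ContDiffOn ℝ 2 V Ω) : ContinuousOn (fderiv ℝ (fderiv ℝ V)) Ω :=
  (hV.fderiv_of_isOpen hΩ (m := 1) (by norm_num)).continuousOn_fderiv_of_isOpen hΩ le_rfl

/-- A lower bound `κ` for the second derivative in direction `h` along the segment
`[z - h, z + h]` bounds the symmetric second difference from below. -/
theorem le_second_difference {Ω : Set E} (hΩ : IsOpen Ω) {V : E → ℝ} (hV : ContDiffOn ℝ 2 V Ω)
    {z h : E} {κ : ℝ} (hmem : ∀ s ∈ Icc (-1 : ℝ) 1, z + s • h ∈ Ω)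
    (hκ : ∀ s ∈ Icc (-1 : ℝ) 1, κ ≤ fderiv ℝ (fderiv ℝ V) (z + s • h) h h) :
    κ ≤ V (z + h) + V (z - h) - 2 * V z := by
  have hline : ∀ s : ℝ, HasDerivAt (fun s : ℝ => z + s • h) h s := fun s => by
    simpa using ((hasDerivAt_id s).smul_const h).const_add z
  have hd1 : ∀ s ∈ Icc (-1 : ℝ) 1,
      HasDerivAt (fun s : ℝ => V (z + s • h)) (fderiv ℝ V (z + s • h) h) s := fun s hs =>
    (((hV.differentiableOn two_ne_zero).differentiableAt
      (hΩ.mem_nhds (hmem s hs))).hasFDerivAt).comp_hasDerivAt s (hline s)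
  have hd2 : ∀ s ∈ Icc (-1 : ℝ) 1, HasDerivAt (fun s : ℝ => fderiv ℝ V (z + s • h) h)
      (fderiv ℝ (fderiv ℝ V) (z + s • h) h h) s := fun s hs => by
    have h0 : HasDerivAt (fun s : ℝ => fderiv ℝ V (z + s • h))
        (fderiv ℝ (fderiv ℝ V) (z + s • h) h) s :=
      (hV.hasFDerivAt_fderiv hΩ (hmem s hs)).comp_hasDerivAt s (hline s)
    exact (ContinuousLinearMap.apply ℝ ℝ h).hasFDerivAt.comp_hasDerivAt s h0
  have hconv : ConvexOn ℝ (Icc (-1 : ℝ) 1) fun s : ℝ => V (z + s • h) - κ / 2 * s ^ 2 := by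
    refine convexOn_of_hasDerivWithinAt2_nonneg (convex_Icc _ _)
      (f' := fun s => fderiv ℝ V (z + s • h) h - κ * s)
      (f'' := fun s => fderiv ℝ (fderiv ℝ V) (z + s • h) h h - κ) ?_ ?_ ?_ ?_
    · exact fun s hs => ((hd1 s hs).continuousAt.sub (by fun_prop)).continuousWithinAt
    · intro s hs
      have h2 : HasDerivAt (fun s : ℝ => κ / 2 * s ^ 2) (κ * s) s := by
        exact ((hasDerivAt_pow 2 s).const_mul (κ / 2)).congr_deriv (by norm_num; ring)
      exact ((hd1 s (interior_subset hs)).sub h2).hasDerivWithinAt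
    · intro s hs
      have h2 : HasDerivAt (fun s : ℝ => κ * s) κ s := by
        simpa using (hasDerivAt_id s).const_mul κ
      exact ((hd2 s (interior_subset hs)).sub h2).hasDerivWithinAt
    · exact fun s hs => sub_nonneg.2 (hκ s (interior_subset hs))
  have := hconv.2 (show (1 : ℝ) ∈ Icc (-1 : ℝ) 1 by norm_num)
    (show (-1 : ℝ) ∈ Icc (-1 : ℝ) 1 by norm_num) (show (0 : ℝ) ≤ 1 / 2 by norm_num)
    (show (0 : ℝ) ≤ 1 / 2 by norm_num) (by norm_num)
  norm_num [sub_eq_add_neg] at this ⊢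
  linarith

theorem abs_symm_difference_sub_le {Ω : Set E} (hΩ : IsOpen Ω) {G : E → ℝ}
    (hG : ContDiffOn ℝ 1 G Ω) {K : Set E} (hK : Convex ℝ K) (hKΩ : K ⊆ Ω) {z h : E} {η : ℝ}
    {φ : E →L[ℝ] ℝ} (h1 : z + h ∈ K) (h2 : z - h ∈ K)
    (hη : ∀ w ∈ K, ‖w - z‖ ≤ ‖h‖ → ‖fderiv ℝ G w - φ‖ ≤ η) :
    |G (z + h) - G (z - h) - 2 * φ h| ≤ 2 * η * ‖h‖ := by
  have := (hK.inter (convex_closedBall z ‖h‖)).norm_image_sub_le_of_norm_fderiv_le' (𝕜 := ℝ)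
    (f := G) (φ := φ) (C := η) (x := z - h) (y := z + h)
    (fun w hw => (hG.differentiableOn one_ne_zero).differentiableAt (hΩ.mem_nhds (hKΩ hw.1)))
    (fun w hw => hη w hw.1 (by simpa [dist_eq_norm] using hw.2))
    ⟨h2, by simp⟩ ⟨h1, by simp⟩
  have e : z + h - (z - h) = (2 : ℝ) • h := by rw [two_smul]; abel
  rw [e, map_smul, norm_smul, Real.norm_eq_abs, Real.norm_eq_abs, abs_two, smul_eq_mul] at this
  linarith

theorem exists_pos_mul_norm_sq_le [FiniteDimensional ℝ E] {K : Set E} (hK : IsCompact K)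
    {B : E → E →L[ℝ] E →L[ℝ] ℝ} (hB : ContinuousOn B K)
    (hpos : ∀ z ∈ K, ∀ h ≠ 0, 0 < B z h h) :
    ∃ c > 0, ∀ z ∈ K, ∀ h, c * ‖h‖ ^ 2 ≤ B z h h := by
  have hcompact : IsCompact (K ×ˢ Metric.sphere (0 : E) 1) :=
    hK.prod (isCompact_sphere 0 1)
  have hcont : ContinuousOn (fun p : E × E => B p.1 p.2 p.2) (K ×ˢ Metric.sphere (0 : E) 1) :=
    ((hB.comp continuousOn_fst fun p hp => hp.1).clm_apply continuousOn_snd).clm_apply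
      continuousOn_snd
  obtain ⟨c, hc, hcB⟩ : ∃ c > 0, ∀ p ∈ K ×ˢ Metric.sphere (0 : E) 1, c ≤ B p.1 p.2 p.2 := by
    rcases (K ×ˢ Metric.sphere (0 : E) 1).eq_empty_or_nonempty with he | hne
    · exact ⟨1, one_pos, by simp [he]⟩
    · obtain ⟨p, hp, hmin⟩ := hcompact.exists_isMinOn hne hcont
      refine ⟨B p.1 p.2 p.2, hpos _ hp.1 _ ?_, fun q hq => hmin hq⟩
      exact ne_zero_of_mem_unit_sphere ⟨p.2, hp.2⟩
  refine ⟨c, hc, fun z hz h => ?_⟩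
  rcases eq_or_ne h 0 with rfl | h0
  · simp
  have hn : ‖h‖ ≠ 0 := norm_ne_zero_iff.2 h0
  have := hcB (z, ‖h‖⁻¹ • h) ⟨hz, by simp [norm_smul, hn]⟩
  simp only [map_smul, _root_.smul_apply, smul_eq_mul] at this
  calc c * ‖h‖ ^ 2 ≤ (‖h‖⁻¹ * (‖h‖⁻¹ * B z h h)) * ‖h‖ ^ 2 := by gcongr
    _ = B z h h := by field_simp

/-- The perturbations `V - tG` and `V + tG` of a strongly convex function `V` have averages at
midpoints that are bounded below by `V - t²Q/2` up to `o(t²)`, as soon as `Q` dominates the squared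
norm of `G'` in the metric dual to `V''`. -/
theorem exists_le_average_of_sq_fderiv_le [FiniteDimensional ℝ E] {Ω K : Set E} (hΩ : IsOpen Ω)
    (hK : IsCompact K) (hKc : Convex ℝ K) (hKΩ : K ⊆ Ω) {V G Q : E → ℝ}
    (hV : ContDiffOn ℝ 2 V Ω) (hG : ContDiffOn ℝ 1 G Ω)
    (hpos : ∀ z ∈ K, ∀ h ≠ 0, 0 < fderiv ℝ (fderiv ℝ V) z h h) (hQ0 : ∀ z ∈ K, 0 ≤ Q z)
    (hQ : ∀ z ∈ K, ∀ h, (fderiv ℝ G z h) ^ 2 ≤ Q z * fderiv ℝ (fderiv ℝ V) z h h)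
    {ε : ℝ} (hε : 0 < ε) :
    ∃ t₀ > 0, ∀ t, 0 < t → t ≤ t₀ → ∀ x ∈ K, ∀ y ∈ K,
      V ((1 / 2 : ℝ) • (x + y)) - t ^ 2 / 2 * (Q ((1 / 2 : ℝ) • (x + y)) + ε) ≤
        ((V x - t * G x) + (V y + t * G y)) / 2 := by
  have hB := (hV.continuousOn_fderiv_fderiv hΩ).mono hKΩ
  have hDG := (hG.continuousOn_fderiv_of_isOpen hΩ le_rfl).mono hKΩ
  obtain ⟨c, hc, hcB⟩ := exists_pos_mul_norm_sq_le hK hB hpos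
  obtain ⟨L, hL⟩ := hK.exists_bound_of_continuousOn hDG
  -- if `‖h‖ > M t`, strong convexity absorbs the first-order term
  set M : ℝ := 2 * (|L| + 1) / c with hM
  have hM0 : 0 < M := by positivity
  have hcM : c * M = 2 * (|L| + 1) := by rw [hM]; field_simp
  set η : ℝ := ε / (M ^ 2 + 2 * M) with hη
  have hη0 : 0 < η := by positivity
  have hηε : η * (M ^ 2 + 2 * M) = ε := by rw [hη]; field_simp
  obtain ⟨δ₁, hδ₁, hu₁⟩ := hK.exists_norm_sub_le_of_continuousOn
    (F := E →L[ℝ] E →L[ℝ] ℝ) hB hη0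
  obtain ⟨δ₂, hδ₂, hu₂⟩ := hK.exists_norm_sub_le_of_continuousOn hDG hη0
  refine ⟨min δ₁ δ₂ / M, by positivity, fun t ht htt₀ x hx y hy => ?_⟩
  set z : E := (1 / 2 : ℝ) • (x + y) with hz
  set h : E := (1 / 2 : ℝ) • (y - x) with hh
  have hzy : z + h = y := by rw [hz, hh]; module
  have hzx : z - h = x := by rw [hz, hh]; module
  have hseg : ∀ s ∈ Icc (-1 : ℝ) 1, z + s • h ∈ K := by
    intro s hs
    have : z + s • h = ((1 - s) / 2) • x + ((1 + s) / 2) • y := by rw [hz, hh]; module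
    rw [this]
    exact hKc hx hy (by linarith [hs.2]) (by linarith [hs.1]) (by ring)
  have hzK : z ∈ K := by simpa using hseg 0 (by norm_num)
  have hQz := hQ0 z hzK
  suffices H : -(t ^ 2 * (Q z + ε)) ≤ (V y + V x - 2 * V z) + t * (G y - G x) by linarith
  -- for `‖h‖ ≤ M t` the Taylor errors are at most `t² ε`
  rcases le_or_gt ‖h‖ (M * t) with hsmall | hlarge
  · have hδ : ‖h‖ ≤ min δ₁ δ₂ := hsmall.trans (by
      rw [le_div_iff₀ hM0] at htt₀; linarith)
    have hsecond : fderiv ℝ (fderiv ℝ V) z h h - η * ‖h‖ ^ 2 ≤ V y + V x - 2 * V z := by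
      have := le_second_difference hΩ hV (z := z) (h := h)
        (κ := fderiv ℝ (fderiv ℝ V) z h h - η * ‖h‖ ^ 2) (fun s hs => hKΩ (hseg s hs)) ?_
      · rwa [hzy, hzx] at this
      intro s hs
      have hdist : ‖fderiv ℝ (fderiv ℝ V) z - fderiv ℝ (fderiv ℝ V) (z + s • h)‖ ≤ η := by
        refine hu₁ _ hzK _ (hseg s hs) ?_
        rw [sub_add_cancel_left, norm_neg, norm_smul, Real.norm_eq_abs]
        calc |s| * ‖h‖ ≤ 1 * ‖h‖ := by gcongr; exact abs_le.2 hs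
          _ ≤ δ₁ := by rw [one_mul]; exact hδ.trans (min_le_left _ _)
      have h3 := (fderiv ℝ (fderiv ℝ V) z - fderiv ℝ (fderiv ℝ V) (z + s • h)).le_opNorm₂ h h
      have h4 : ‖fderiv ℝ (fderiv ℝ V) z - fderiv ℝ (fderiv ℝ V) (z + s • h)‖ * ‖h‖ * ‖h‖ ≤
          η * ‖h‖ ^ 2 := by rw [mul_assoc, ← sq]; gcongr
      have h5 := (le_abs_self _).trans (h3.trans h4)
      simp only [_root_.sub_apply] at h5
      linarith
    have hfirst : |G y - G x - 2 * fderiv ℝ G z h| ≤ 2 * η * ‖h‖ := by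
      have := abs_symm_difference_sub_le hΩ hG hKc hKΩ (z := z) (h := h) (η := η)
        (φ := fderiv ℝ G z) (hzy ▸ hy) (hzx ▸ hx) ?_
      · rwa [hzy, hzx] at this
      intro w hw hwz
      exact hu₂ _ hw _ hzK (hwz.trans (hδ.trans (min_le_right _ _)))
    have hquad : 0 ≤ fderiv ℝ (fderiv ℝ V) z h h + 2 * t * fderiv ℝ G z h + t ^ 2 * Q z := by
      rcases eq_or_ne h 0 with h0 | h0
      · rw [h0, map_zero, map_zero]
        positivity
      · have hp := hpos z hzK h h0
        have hq := hQ z hzK h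
        refine nonneg_of_mul_nonneg_right (a := fderiv ℝ (fderiv ℝ V) z h h) ?_ hp
        nlinarith [sq_nonneg (fderiv ℝ (fderiv ℝ V) z h h + t * fderiv ℝ G z h),
          mul_le_mul_of_nonneg_left hq (sq_nonneg t)]
    have h6 := mul_le_mul_of_nonneg_left (abs_le.1 hfirst).1 ht.le
    have h7 : η * ‖h‖ ^ 2 + 2 * t * η * ‖h‖ ≤ t ^ 2 * ε := by
      calc η * ‖h‖ ^ 2 + 2 * t * η * ‖h‖ ≤ η * (M * t) ^ 2 + 2 * t * η * (M * t) := by gcongr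
        _ = t ^ 2 * (η * (M ^ 2 + 2 * M)) := by ring
        _ = t ^ 2 * ε := by rw [hηε]
    linarith
  · have hsecond : c * ‖h‖ ^ 2 ≤ V y + V x - 2 * V z := by
      have := le_second_difference hΩ hV (z := z) (h := h) (κ := c * ‖h‖ ^ 2)
        (fun s hs => hKΩ (hseg s hs)) fun s hs => hcB _ (hseg s hs) h
      rwa [hzy, hzx] at this
    have hfirst : |G y - G x| ≤ 2 * (|L| + 1) * ‖h‖ := by
      have := abs_symm_difference_sub_le hΩ hG hKc hKΩ (z := z) (h := h) (η := |L| + 1)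
        (φ := 0) (hzy ▸ hy) (hzx ▸ hx) fun w hw _ => by
          rw [sub_zero]
          linarith [hL w hw, le_abs_self L]
      simpa [hzy, hzx] using this
    have h6 := mul_le_mul_of_nonneg_left (abs_le.1 hfirst).1 ht.le
    have h7 : 0 ≤ c * ‖h‖ * (‖h‖ - M * t) :=
      mul_nonneg (by positivity) (by linarith)
    have h8 : c * ‖h‖ * (‖h‖ - M * t) = c * ‖h‖ ^ 2 - c * M * t * ‖h‖ := by ring
    rw [h8, hcM] at h7
    have h9 : 0 ≤ t ^ 2 * (Q z + ε) := by positivity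
    linarith

end Midpoint

/-! ### Scalar expansions -/

theorem eventually_le_one_add_rpow_neg {β η : ℝ} (hη : 0 < η) :
    ∀ᶠ u : ℝ in 𝓝 0, 1 - β * u + (β * (β + 1) / 2 - η) * u ^ 2 ≤ (1 + u) ^ (-β) := by
  set φ : ℝ → ℝ := fun u => (1 + u) ^ (-β) - (1 - β * u + (β * (β + 1) / 2 - η) * u ^ 2) with hφ
  have hd : ∀ p u : ℝ, -1 < u → HasDerivAt (fun u : ℝ => (1 + u) ^ p) (p * (1 + u) ^ (p - 1)) u := by
    intro p u hu
    have := ((hasDerivAt_id u).const_add 1).rpow_const (p := p) (.inl (by simp; linarith))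
    simpa using this
  have hd1 : ∀ u : ℝ, -1 < u → HasDerivAt φ
      (-β * (1 + u) ^ (-β - 1) + β - (β * (β + 1) - 2 * η) * u) u := by
    intro u hu
    have h2 : HasDerivAt (fun u : ℝ => 1 - β * u + (β * (β + 1) / 2 - η) * u ^ 2)
        (-β + (β * (β + 1) / 2 - η) * (2 * u)) u := by
      have a := ((hasDerivAt_id u).const_mul β).const_sub 1
      have b := (hasDerivAt_pow 2 u).const_mul (β * (β + 1) / 2 - η)
      exact (a.add b).congr_deriv (by norm_num)
    exact ((hd (-β) u hu).sub h2).congr_deriv (by ring)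
  have hderiv : deriv φ =ᶠ[𝓝 0] fun u =>
      -β * (1 + u) ^ (-β - 1) + β - (β * (β + 1) - 2 * η) * u := by
    filter_upwards [lt_mem_nhds (show (-1 : ℝ) < 0 by norm_num)] with u hu
    exact (hd1 u hu).deriv
  have hd2 : deriv (deriv φ) 0 = 2 * η := by
    rw [hderiv.deriv_eq]
    have a := (((hd (-β - 1) 0 (by norm_num)).const_mul (-β)).add_const β).sub
      ((hasDerivAt_id (0 : ℝ)).const_mul (β * (β + 1) - 2 * η))
    refine a.deriv.trans ?_
    simp
    ring
  have hmin : IsLocalMin φ 0 := by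
    refine isLocalMin_of_deriv_deriv_pos (by rw [hd2]; positivity) ?_
      (hd1 0 (by norm_num)).continuousAt
    rw [(hd1 0 (by norm_num)).deriv]
    simp
  filter_upwards [hmin] with u hu
  have h0 : φ 0 = 0 := by simp [hφ]
  rw [h0] at hu
  simp only [hφ] at hu
  linarith

theorem eventually_one_sub_rpow_neg_le {β η : ℝ} (hη : 0 < η) :
    ∀ᶠ w : ℝ in 𝓝 0, 0 ≤ w → (1 - w) ^ (-β) ≤ 1 + (β + η) * w := by
  have hd : HasDerivAt (fun w : ℝ => (1 - w) ^ (-β)) β 0 := by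
    have := ((hasDerivAt_id (0 : ℝ)).const_sub 1).rpow_const (p := -β) (.inl (by simp))
    simpa using this
  have := (hasDerivAt_iff_isLittleO.1 hd).def hη
  filter_upwards [this] with w hw hw0
  simp only [sub_zero, Real.one_rpow, smul_eq_mul, Real.norm_eq_abs, abs_of_nonneg hw0] at hw
  linarith [(abs_le.1 hw).2]

/-! ### The dimensional variance inequality on compact convex sets -/

theorem negPowerMean_ofReal_rpow_neg_le {n : ℕ} (hn : 1 ≤ n) {β : ℝ} (hβ : (n : ℝ) ≤ β)
    {a b u : ℝ} (ha : 0 < a) (hb : 0 < b) (hu : 0 < u) (h : u ≤ (a + b) / 2) :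
    negPowerMean n (ENNReal.ofReal (a ^ (-β))) (ENNReal.ofReal (b ^ (-β))) ≤
      ENNReal.ofReal (u ^ (-β)) := by
  have hn0 : (0 : ℝ) < n := by exact_mod_cast hn
  have hp : 1 ≤ β * (n : ℝ)⁻¹ := by
    rw [← div_eq_mul_inv, one_le_div hn0]
    exact hβ
  have hroot : ∀ {c : ℝ}, 0 < c → (ENNReal.ofReal (c ^ (-β)))⁻¹ ^ (n : ℝ)⁻¹ =
      ENNReal.ofReal (c ^ (β * (n : ℝ)⁻¹)) := by
    intro c hc
    rw [← ENNReal.ofReal_inv_of_pos (Real.rpow_pos_of_pos hc _), Real.rpow_neg hc.le, inv_inv,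
      ENNReal.ofReal_rpow_of_pos (Real.rpow_pos_of_pos hc _), ← Real.rpow_mul hc.le]
  have hmean : u ^ (β * (n : ℝ)⁻¹) ≤ (a ^ (β * (n : ℝ)⁻¹) + b ^ (β * (n : ℝ)⁻¹)) / 2 := by
    have hc := (convexOn_rpow hp).2 (mem_Ici.2 ha.le) (mem_Ici.2 hb.le)
      (show (0 : ℝ) ≤ 1 / 2 by norm_num) (show (0 : ℝ) ≤ 1 / 2 by norm_num) (by norm_num)
    simp only [smul_eq_mul] at hc
    calc u ^ (β * (n : ℝ)⁻¹) ≤ (1 / 2 * a + 1 / 2 * b) ^ (β * (n : ℝ)⁻¹) :=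
          Real.rpow_le_rpow hu.le (by linarith) (by linarith)
      _ ≤ _ := by linarith
  have hn' : n ≠ 0 := by omega
  have hpos : 0 < (a ^ (β * (n : ℝ)⁻¹) + b ^ (β * (n : ℝ)⁻¹)) / 2 := by positivity
  rw [negPowerMean, if_neg hn', hroot ha, hroot hb, ← ENNReal.ofReal_add (by positivity)
    (by positivity), show (2 : ℝ≥0∞) = ENNReal.ofReal 2 by simp,
    ← ENNReal.ofReal_div_of_pos two_pos, ← ENNReal.ofReal_pow hpos.le,
    ← ENNReal.ofReal_inv_of_pos (by positivity)]
  refine ENNReal.ofReal_le_ofReal ?_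
  rw [Real.rpow_neg hu.le]
  have e : u ^ β = (u ^ (β * (n : ℝ)⁻¹)) ^ n := by
    rw [← Real.rpow_natCast, ← Real.rpow_mul hu.le, inv_mul_cancel_right₀ hn0.ne']
  rw [e]
  gcongr

theorem min_setIntegral_rpow_neg_le {n : ℕ} (hn : 1 ≤ n) {β : ℝ} (hβ : (n : ℝ) ≤ β)
    {K : Set (EuclideanSpace ℝ (Fin n))} (hK : IsCompact K) (hKc : Convex ℝ K)
    {A B U : EuclideanSpace ℝ (Fin n) → ℝ} (hA : ContinuousOn A K) (hB : ContinuousOn B K)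
    (hU : ContinuousOn U K) (hA0 : ∀ x ∈ K, 0 < A x) (hB0 : ∀ x ∈ K, 0 < B x)
    (hU0 : ∀ x ∈ K, 0 < U x)
    (h : ∀ x ∈ K, ∀ y ∈ K, U ((1 / 2 : ℝ) • (x + y)) ≤ (A x + B y) / 2) :
    min (∫ x in K, A x ^ (-β)) (∫ x in K, B x ^ (-β)) ≤ ∫ x in K, U x ^ (-β) := by
  have hcont : ∀ {C : EuclideanSpace ℝ (Fin n) → ℝ}, ContinuousOn C K → (∀ x ∈ K, 0 < C x) →
      ContinuousOn (fun x => C x ^ (-β)) K := fun hC hC0 =>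
    hC.rpow_const fun x hx => .inl (hC0 x hx).ne'
  have hmeas : ∀ {C : EuclideanSpace ℝ (Fin n) → ℝ}, ContinuousOn C K → (∀ x ∈ K, 0 < C x) →
      Measurable (K.indicator fun x => ENNReal.ofReal (C x ^ (-β))) := by
    intro C hC hC0
    classical
    rw [← piecewise_eq_indicator]
    exact (ENNReal.continuous_ofReal.comp_continuousOn (hcont hC hC0)).measurable_piecewise
      continuousOn_const hK.measurableSet
  have hint : ∀ {C : EuclideanSpace ℝ (Fin n) → ℝ}, ContinuousOn C K → (∀ x ∈ K, 0 < C x) →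
      ∫⁻ x, K.indicator (fun x => ENNReal.ofReal (C x ^ (-β))) x =
        ENNReal.ofReal (∫ x in K, C x ^ (-β)) := by
    intro C hC hC0
    rw [lintegral_indicator hK.measurableSet, ofReal_integral_eq_lintegral_ofReal
      ((hcont hC hC0).integrableOn_compact hK)]
    exact (ae_restrict_iff' hK.measurableSet).2
      (ae_of_all _ fun x hx => Real.rpow_nonneg (hC0 x hx).le _)
  have key := min_lintegral_le_of_negPowerMean_le (hmeas hA hA0) (hmeas hB hB0) (hmeas hU hU0) ?_
  · rw [hint hA hA0, hint hB hB0, hint hU hU0, ← ENNReal.ofReal_min] at key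
    refine (ENNReal.ofReal_le_ofReal_iff ?_).1 key
    exact setIntegral_nonneg hK.measurableSet fun x hx => Real.rpow_nonneg (hU0 x hx).le _
  · intro x y
    by_cases hx : x ∈ K
    swap
    · simp [hx, negPowerMean_zero_left]
    by_cases hy : y ∈ K
    swap
    · simp [hy, negPowerMean_zero_right]
    have hz : (1 / 2 : ℝ) • (x + y) ∈ K := by
      rw [smul_add]
      exact hKc hx hy (by norm_num) (by norm_num) (by norm_num)
    rw [indicator_of_mem hx, indicator_of_mem hy, indicator_of_mem hz]
    exact negPowerMean_ofReal_rpow_neg_le hn hβ (hA0 x hx) (hB0 y hy) (hU0 _ hz) (h x hx y hy)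

/-- Comparison of the terms of order `t²` in the Borell–Brascamp–Lieb inequality for the densities
`(V ± t g V)^(-β)`, up to an error `η`. -/
theorem integral_sq_mul_rpow_neg_le_add {n : ℕ} (hn : 1 ≤ n) {β : ℝ} (hβ : (n : ℝ) ≤ β)
    {Ω K : Set (EuclideanSpace ℝ (Fin n))} (hΩ : IsOpen Ω) (hK : IsCompact K) (hKc : Convex ℝ K)
    (hKΩ : K ⊆ Ω) {V g P : EuclideanSpace ℝ (Fin n) → ℝ} (hV : ContDiffOn ℝ 2 V Ω)
    (hg : ContDiffOn ℝ 1 g Ω) (hP : ContinuousOn P K) (hV0 : ∀ x ∈ K, 0 < V x)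
    (hP0 : ∀ x ∈ K, 0 ≤ P x) (hpos : ∀ z ∈ K, ∀ h ≠ 0, 0 < fderiv ℝ (fderiv ℝ V) z h h)
    (hPV : ∀ z ∈ K, ∀ h, (fderiv ℝ (fun x => g x * V x) z h) ^ 2 ≤
      P z * V z * fderiv ℝ (fderiv ℝ V) z h h)
    (hmean : ∫ x in K, g x * V x ^ (-β) = 0) {η : ℝ} (hη : 0 < η) :
    (β * (β + 1) / 2 - η) * ∫ x in K, g x ^ 2 * V x ^ (-β) ≤
      (β + η) / 2 * ((∫ x in K, P x * V x ^ (-β)) + η * ∫ x in K, V x ^ (-β)) := by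
  have hVK := hV.continuousOn.mono hKΩ
  have hgK := hg.continuousOn.mono hKΩ
  have hρ : ContinuousOn (fun x => V x ^ (-β)) K :=
    hVK.rpow_const fun x hx => .inl (hV0 x hx).ne'
  obtain ⟨v, hv, hvV⟩ := hK.exists_forall_le' hVK hV0
  obtain ⟨A, hA⟩ := hK.exists_bound_of_continuousOn hgK
  obtain ⟨C, hC⟩ := hK.exists_bound_of_continuousOn hP
  obtain ⟨t₀, ht₀, hmid⟩ := exists_le_average_of_sq_fderiv_le hΩ hK hKc hKΩ hV
    ((hg.mul (hV.of_le one_le_two) : ContDiffOn ℝ 1 (fun x => g x * V x) Ω))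
    hpos (fun z hz => mul_nonneg (hP0 z hz) (hV0 z hz).le) hPV (mul_pos hη hv)
  obtain ⟨δ₁, hδ₁, hu⟩ := Metric.eventually_nhds_iff.1
    ((eventually_le_one_add_rpow_neg (β := β) hη).and (lt_mem_nhds (show (-1 : ℝ) < 0 by norm_num)))
  obtain ⟨δ₂, hδ₂, hw⟩ := Metric.eventually_nhds_iff.1
    ((eventually_one_sub_rpow_neg_le (β := β) hη).and (gt_mem_nhds (show (0 : ℝ) < 1 by norm_num)))
  obtain ⟨t, ht, htt₀, htA, htC⟩ : ∃ t > 0, t ≤ t₀ ∧ t * |A| < δ₁ ∧ t ^ 2 / 2 * (|C| + η) < δ₂ := by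
    have e1 : ∀ᶠ t : ℝ in 𝓝[>] 0, t * |A| < δ₁ :=
      (((continuous_id.mul continuous_const).tendsto' (0 : ℝ) 0 (by simp)).mono_left
        nhdsWithin_le_nhds).eventually (gt_mem_nhds hδ₁)
    have e2 : ∀ᶠ t : ℝ in 𝓝[>] 0, t ^ 2 / 2 * (|C| + η) < δ₂ :=
      (((by fun_prop : Continuous fun t : ℝ => t ^ 2 / 2 * (|C| + η)).tendsto' (0 : ℝ) 0
        (by simp)).mono_left nhdsWithin_le_nhds).eventually (gt_mem_nhds hδ₂)
    have e3 : ∀ᶠ t : ℝ in 𝓝[>] 0, t ∈ Ioc 0 t₀ := Ioc_mem_nhdsGT ht₀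
    obtain ⟨t, h1, h2, h3⟩ := (e3.and (e1.and e2)).exists
    exact ⟨t, h1.1, h1.2, h2, h3⟩
  have hsmall : ∀ σ : ℝ, |σ| = 1 → ∀ x ∈ K, dist (σ * t * g x) 0 < δ₁ := by
    intro σ hσ x hx
    rw [dist_zero_right, Real.norm_eq_abs, abs_mul, abs_mul, hσ, one_mul, abs_of_pos ht]
    refine lt_of_le_of_lt ?_ htA
    exact mul_le_mul_of_nonneg_left ((hA x hx).trans (le_abs_self _)) ht.le
  have hsmall' : ∀ x ∈ K, dist (t ^ 2 / 2 * (P x + η)) 0 < δ₂ := by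
    intro x hx
    have := hP0 x hx
    rw [dist_zero_right, Real.norm_eq_abs, abs_of_nonneg (by positivity)]
    refine lt_of_le_of_lt ?_ htC
    gcongr
    exact (le_abs_self _).trans ((hC x hx).trans (le_abs_self _))
  have hI : ∀ {k : EuclideanSpace ℝ (Fin n) → ℝ}, ContinuousOn k K → IntegrableOn k K :=
    fun hk => hk.integrableOn_compact hK
  have hfac : ∀ {x : EuclideanSpace ℝ (Fin n)}, x ∈ K → ∀ {r : ℝ}, 0 < r →
      (V x * r) ^ (-β) = V x ^ (-β) * r ^ (-β) := fun hx _ hr =>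
    Real.mul_rpow (hV0 _ hx).le hr.le
  have hpert : ∀ σ : ℝ, |σ| = 1 → ContinuousOn (fun x => V x * (1 + σ * t * g x)) K := by
    intro σ _
    fun_prop
  have hpert0 : ∀ σ : ℝ, |σ| = 1 → ∀ x ∈ K, 0 < 1 + σ * t * g x := fun σ hσ x hx => by
    linarith [(hu (hsmall σ hσ x hx)).2]
  have hlower : ∀ σ : ℝ, |σ| = 1 →
      (∫ x in K, V x ^ (-β)) + (β * (β + 1) / 2 - η) * t ^ 2 * ∫ x in K, g x ^ 2 * V x ^ (-β) ≤
        ∫ x in K, (V x * (1 + σ * t * g x)) ^ (-β) := by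
    intro σ hσ
    have hσ2 : σ ^ 2 = 1 := by rw [← sq_abs, hσ, one_pow]
    have i1 : IntegrableOn (fun x => V x ^ (-β)) K := hI hρ
    have i2 : IntegrableOn (fun x => β * σ * t * (g x * V x ^ (-β))) K :=
      (hI (hgK.mul hρ)).const_mul _
    have i3 : IntegrableOn (fun x => (β * (β + 1) / 2 - η) * t ^ 2 * (g x ^ 2 * V x ^ (-β))) K :=
      (hI ((hgK.pow 2).mul hρ)).const_mul _
    have i12 : IntegrableOn (fun x => V x ^ (-β) - β * σ * t * (g x * V x ^ (-β))) K := i1.sub i2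
    calc _ = ∫ x in K, (V x ^ (-β) - β * σ * t * (g x * V x ^ (-β)) +
          (β * (β + 1) / 2 - η) * t ^ 2 * (g x ^ 2 * V x ^ (-β))) := by
          rw [integral_add i12 i3, integral_sub i1 i2, integral_const_mul,
            integral_const_mul, hmean, mul_zero, sub_zero]
      _ ≤ _ := by
          refine setIntegral_mono_on (i12.add i3)
            (hI ((hpert σ hσ).rpow_const fun x hx =>
              .inl (mul_pos (hV0 x hx) (hpert0 σ hσ x hx)).ne')) hK.measurableSet fun x hx => ?_
          rw [hfac hx (hpert0 σ hσ x hx)]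
          have h1 := mul_le_mul_of_nonneg_left (hu (hsmall σ hσ x hx)).1
            (Real.rpow_nonneg (hV0 x hx).le (-β))
          refine le_trans (le_of_eq ?_) h1
          rw [show (σ * t * g x) ^ 2 = σ ^ 2 * (t * g x) ^ 2 by ring, hσ2]
          ring
  have hrest : ∀ x ∈ K, 0 < 1 - t ^ 2 / 2 * (P x + η) := fun x hx =>
    sub_pos.2 (hw (hsmall' x hx)).2
  have hupper : ∫ x in K, (V x * (1 - t ^ 2 / 2 * (P x + η))) ^ (-β) ≤
      (∫ x in K, V x ^ (-β)) + (β + η) / 2 * t ^ 2 *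
        ((∫ x in K, P x * V x ^ (-β)) + η * ∫ x in K, V x ^ (-β)) := by
    have i1 : IntegrableOn (fun x => V x ^ (-β)) K := hI hρ
    have i2 : IntegrableOn (fun x => P x * V x ^ (-β)) K := hI (hP.mul hρ)
    have i3 : IntegrableOn (fun x => P x * V x ^ (-β) + η * V x ^ (-β)) K :=
      i2.add (i1.const_mul _)
    calc _ ≤ ∫ x in K, (V x ^ (-β) + (β + η) / 2 * t ^ 2 *
          (P x * V x ^ (-β) + η * V x ^ (-β))) := by
          refine setIntegral_mono_on
            (hI (ContinuousOn.rpow_const (by fun_prop) fun x hx =>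
              .inl (mul_pos (hV0 x hx) (hrest x hx)).ne')) (i1.add (i3.const_mul _))
            hK.measurableSet fun x hx => ?_
          rw [hfac hx (hrest x hx)]
          have := hP0 x hx
          have h1 := mul_le_mul_of_nonneg_left ((hw (hsmall' x hx)).1 (by positivity))
            (Real.rpow_nonneg (hV0 x hx).le (-β))
          refine h1.trans (le_of_eq ?_)
          ring
      _ = _ := by
          rw [integral_add i1 (i3.const_mul _), integral_const_mul,
            integral_add i2 (i1.const_mul _), integral_const_mul]
  -- with mean zero, both integrals in the minimum have the same lower bound up to order `t²`
  have hbbl := min_setIntegral_rpow_neg_le hn hβ hK hKc (hpert (-1) (by simp)) (hpert 1 (by simp))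
    (U := fun x => V x * (1 - t ^ 2 / 2 * (P x + η))) (by fun_prop)
    (fun x hx => mul_pos (hV0 x hx) (hpert0 _ (by simp) x hx))
    (fun x hx => mul_pos (hV0 x hx) (hpert0 _ (by simp) x hx))
    (fun x hx => mul_pos (hV0 x hx) (hrest x hx)) ?_
  · have h1 := (le_min (hlower (-1) (by simp)) (hlower 1 (by simp))).trans (hbbl.trans hupper)
    have ht2 : 0 < t ^ 2 := by positivity
    refine le_of_mul_le_mul_left (a := t ^ 2) ?_ ht2
    linarith
  · intro x hx y hy
    have hz : (1 / 2 : ℝ) • (x + y) ∈ K := by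
      rw [smul_add]
      exact hKc hx hy (by norm_num) (by norm_num) (by norm_num)
    have h1 := hmid t ht htt₀ x hx y hy
    have h2 := mul_le_mul_of_nonneg_left (hvV _ hz) (by positivity : 0 ≤ t ^ 2 / 2 * η)
    linarith

/-- **Dimensional variance inequality.** Let `V > 0` be convex on a compact convex set `K` and
`β ≥ n`. If `g` has mean zero for the density `V^(-β)` and `P V` dominates the squared norm of
`(g V)'` in the metric dual to `V''`, then `(β + 1) ∫ g² V^(-β) ≤ ∫ P V^(-β)` over `K`. -/
theorem integral_sq_mul_rpow_neg_le {n : ℕ} (hn : 1 ≤ n) {β : ℝ} (hβ : (n : ℝ) ≤ β)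
    {Ω K : Set (EuclideanSpace ℝ (Fin n))} (hΩ : IsOpen Ω) (hK : IsCompact K) (hKc : Convex ℝ K)
    (hKΩ : K ⊆ Ω) {V g P : EuclideanSpace ℝ (Fin n) → ℝ} (hV : ContDiffOn ℝ 2 V Ω)
    (hg : ContDiffOn ℝ 1 g Ω) (hP : ContinuousOn P K) (hV0 : ∀ x ∈ K, 0 < V x)
    (hP0 : ∀ x ∈ K, 0 ≤ P x) (hpos : ∀ z ∈ K, ∀ h ≠ 0, 0 < fderiv ℝ (fderiv ℝ V) z h h)
    (hPV : ∀ z ∈ K, ∀ h, (fderiv ℝ (fun x => g x * V x) z h) ^ 2 ≤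
      P z * V z * fderiv ℝ (fderiv ℝ V) z h h)
    (hmean : ∫ x in K, g x * V x ^ (-β) = 0) :
    (β + 1) * ∫ x in K, g x ^ 2 * V x ^ (-β) ≤ ∫ x in K, P x * V x ^ (-β) := by
  have hβ0 : 0 < β := lt_of_lt_of_le (by exact_mod_cast hn) hβ
  set I := ∫ x in K, V x ^ (-β)
  set J := ∫ x in K, g x ^ 2 * V x ^ (-β)
  set S := ∫ x in K, P x * V x ^ (-β)
  have l1 : Tendsto (fun η : ℝ => (β * (β + 1) / 2 - η) * J) (𝓝[>] 0)
      (𝓝 ((β * (β + 1) / 2 - 0) * J)) :=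
    ((by fun_prop : Continuous fun η : ℝ => (β * (β + 1) / 2 - η) * J).tendsto 0).mono_left
      nhdsWithin_le_nhds
  have l2 : Tendsto (fun η : ℝ => (β + η) / 2 * (S + η * I)) (𝓝[>] 0)
      (𝓝 ((β + 0) / 2 * (S + 0 * I))) :=
    ((by fun_prop : Continuous fun η : ℝ => (β + η) / 2 * (S + η * I)).tendsto 0).mono_left
      nhdsWithin_le_nhds
  have hle := le_of_tendsto_of_tendsto l1 l2 (by
    filter_upwards [self_mem_nhdsWithin] with η hη
    exact integral_sq_mul_rpow_neg_le_add hn hβ hΩ hK hKc hKΩ hV hg hP hV0 hP0 hpos hPV hmean hη)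
  refine le_of_mul_le_mul_left (a := β / 2) ?_ (by positivity)
  linarith

/-! ### The matrix `R` and the exponential potential -/

/-- The Cauchy–Schwarz inequality for the inner product of `R`, applied to `R⁻¹ v` and `h`. -/
theorem Matrix.PosDef.sq_dotProduct_le {n : ℕ} {R : Matrix (Fin n) (Fin n) ℝ} (hR : R.PosDef)
    (v h : Fin n → ℝ) : (v ⬝ᵥ h) ^ 2 ≤ (v ⬝ᵥ R⁻¹.mulVec v) * (h ⬝ᵥ R.mulVec h) := by
  set u := R⁻¹.mulVec v with hu
  have hRu : R.mulVec u = v := by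
    rw [hu, Matrix.mulVec_mulVec, Matrix.mul_nonsing_inv _ ((Matrix.isUnit_iff_isUnit_det _).1
      hR.isUnit), Matrix.one_mulVec]
  have hsymm : u ⬝ᵥ R.mulVec h = v ⬝ᵥ h := by
    rw [Matrix.dotProduct_mulVec, ← Matrix.mulVec_transpose,
      show R.transpose = R from hR.isHermitian, hRu]
  have hd := discrim_le_zero (a := h ⬝ᵥ R.mulVec h) (b := 2 * (v ⬝ᵥ h)) (c := v ⬝ᵥ u) fun s => by
    have h0 := hR.posSemidef.dotProduct_mulVec_nonneg (u + s • h)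
    simp only [star_trivial, Matrix.mulVec_add, Matrix.mulVec_smul, add_dotProduct,
      dotProduct_add, smul_dotProduct, dotProduct_smul, smul_eq_mul, hRu, hsymm,
      dotProduct_comm u v, dotProduct_comm h v] at h0
    linarith
  rw [discrim] at hd
  linarith

theorem dotProduct_hessianMatrix_mulVec {n : ℕ} (W : EuclideanSpace ℝ (Fin n) → ℝ)
    (z h : EuclideanSpace ℝ (Fin n)) :
    h.ofLp ⬝ᵥ (hessianMatrix W z).mulVec h.ofLp = fderiv ℝ (fderiv ℝ W) z h h := by
  have hh : h = ∑ i, h i • EuclideanSpace.single i (1 : ℝ) := by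
    simpa using ((EuclideanSpace.basisFun (Fin n) ℝ).sum_repr h).symm
  conv_rhs => rw [hh]
  simp only [map_sum, map_smul, _root_.sum_apply, _root_.smul_apply, smul_eq_mul,
    dotProduct, Matrix.mulVec, hessianMatrix, Matrix.of_apply, Finset.mul_sum]
  rw [Finset.sum_comm]
  refine Finset.sum_congr rfl fun i _ => Finset.sum_congr rfl fun j _ => ?_
  ring

theorem tensorSquare_eq_vecMulVec {n : ℕ} (v : EuclideanSpace ℝ (Fin n)) :
    tensorSquare v = Matrix.vecMulVec v.ofLp (star v.ofLp) := by
  ext i j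
  simp [tensorSquare, Matrix.vecMulVec_apply]

theorem gradient_dotProduct {n : ℕ} (f : EuclideanSpace ℝ (Fin n) → ℝ)
    (z h : EuclideanSpace ℝ (Fin n)) : (gradient f z).ofLp ⬝ᵥ h.ofLp = fderiv ℝ f z h := by
  rw [← inner_gradient_left, EuclideanSpace.inner_eq_star_dotProduct, star_trivial,
    dotProduct_comm]

theorem dotProduct_matrixR_mulVec {n : ℕ} (W : EuclideanSpace ℝ (Fin n) → ℝ) (β : ℝ)
    (z h : EuclideanSpace ℝ (Fin n)) :
    h.ofLp ⬝ᵥ (matrixR W β z).mulVec h.ofLp =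
      fderiv ℝ (fderiv ℝ W) z h h + 1 / β * (fderiv ℝ W z h) ^ 2 := by
  rw [matrixR, Matrix.add_mulVec, dotProduct_add, dotProduct_hessianMatrix_mulVec,
    Matrix.smul_mulVec, dotProduct_smul, smul_eq_mul, tensorSquare_eq_vecMulVec,
    Matrix.vecMulVec_mulVec, star_trivial, gradient_dotProduct]
  simp [dotProduct_comm h.ofLp, gradient_dotProduct]
  ring_nf
  simp

theorem matrixR_posDef {n : ℕ} {W : EuclideanSpace ℝ (Fin n) → ℝ} {β : ℝ} (hβ : 0 < β)
    {z : EuclideanSpace ℝ (Fin n)} (h : (hessianMatrix W z).PosDef) : (matrixR W β z).PosDef := by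
  refine h.add_posSemidef (Matrix.PosSemidef.smul ?_ (by positivity))
  rw [tensorSquare_eq_vecMulVec]
  exact Matrix.posSemidef_vecMulVec_self_star _

/-- The integrand `⟨R⁻¹ ∇g, ∇g⟩` of the right-hand side. -/
noncomputable def dualEnergy {n : ℕ} (W : EuclideanSpace ℝ (Fin n) → ℝ) (β : ℝ)
    (g : EuclideanSpace ℝ (Fin n) → ℝ) (x : EuclideanSpace ℝ (Fin n)) : ℝ :=
  inner ℝ (Matrix.toEuclideanLin (matrixR W β x)⁻¹ (gradient g x)) (gradient g x)

theorem dualEnergy_eq {n : ℕ} (W : EuclideanSpace ℝ (Fin n) → ℝ) (β : ℝ)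
    (g : EuclideanSpace ℝ (Fin n) → ℝ) (x : EuclideanSpace ℝ (Fin n)) :
    dualEnergy W β g x =
      (gradient g x).ofLp ⬝ᵥ (matrixR W β x)⁻¹.mulVec (gradient g x).ofLp := by
  rw [dualEnergy, EuclideanSpace.inner_eq_star_dotProduct, star_trivial]
  rfl

theorem dualEnergy_nonneg {n : ℕ} {W : EuclideanSpace ℝ (Fin n) → ℝ} {β : ℝ} (hβ : 0 < β)
    (g : EuclideanSpace ℝ (Fin n) → ℝ) {x : EuclideanSpace ℝ (Fin n)}
    (h : (hessianMatrix W x).PosDef) : 0 ≤ dualEnergy W β g x := by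
  rw [dualEnergy_eq]
  simpa using (matrixR_posDef hβ h).inv.posSemidef.dotProduct_mulVec_nonneg (gradient g x).ofLp

theorem sq_fderiv_le_dualEnergy_mul {n : ℕ} {W : EuclideanSpace ℝ (Fin n) → ℝ} {β : ℝ}
    (hβ : 0 < β) (g : EuclideanSpace ℝ (Fin n) → ℝ) {x : EuclideanSpace ℝ (Fin n)}
    (hx : (hessianMatrix W x).PosDef) (h : EuclideanSpace ℝ (Fin n)) :
    (fderiv ℝ g x h) ^ 2 ≤ dualEnergy W β g x *
      (fderiv ℝ (fderiv ℝ W) x h h + 1 / β * (fderiv ℝ W x h) ^ 2) := by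
  rw [dualEnergy_eq, ← dotProduct_matrixR_mulVec, ← gradient_dotProduct]
  exact (matrixR_posDef hβ hx).sq_dotProduct_le _ _

theorem continuousOn_dualEnergy {n : ℕ} {Ω : Set (EuclideanSpace ℝ (Fin n))} (hΩ : IsOpen Ω)
    {W g : EuclideanSpace ℝ (Fin n) → ℝ} (hW : ContDiffOn ℝ 2 W Ω)
    (hW' : ∀ x ∈ Ω, (hessianMatrix W x).PosDef) (hg : ContDiffOn ℝ 1 g Ω) {β : ℝ} (hβ : 0 < β) :
    ContinuousOn (dualEnergy W β g) Ω := by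
  have hgrad : ∀ {f : EuclideanSpace ℝ (Fin n) → ℝ}, ContDiffOn ℝ 1 f Ω →
      ContinuousOn (fun x => (gradient f x).ofLp) Ω := fun hf =>
    (PiLp.continuous_ofLp 2 _).comp_continuousOn
      ((InnerProductSpace.toDual ℝ (EuclideanSpace ℝ (Fin n))).symm.continuous.comp_continuousOn
        (hf.continuousOn_fderiv_of_isOpen hΩ le_rfl))
  have hhess : ContinuousOn (hessianMatrix W) Ω := by
    refine continuousOn_pi.2 fun i => continuousOn_pi.2 fun j => ?_
    exact ((hW.continuousOn_fderiv_fderiv hΩ).clm_apply continuousOn_const).clm_apply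
      continuousOn_const
  have hR : ContinuousOn (matrixR W β) Ω := by
    have h1 := hgrad (hW.of_le one_le_two)
    have h2 : ContinuousOn (fun x => tensorSquare (gradient W x)) Ω :=
      continuousOn_pi.2 fun i => continuousOn_pi.2 fun j =>
        (continuousOn_pi.1 h1 i).mul (continuousOn_pi.1 h1 j)
    exact hhess.add (h2.const_smul (1 / β))
  have hinv : ContinuousOn (fun x => (matrixR W β x)⁻¹) Ω := by
    simp only [Matrix.inv_def, Ring.inverse_eq_inv']
    have hdet : ContinuousOn (fun x => (matrixR W β x).det) Ω :=
      continuous_id.matrix_det.comp_continuousOn hR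
    have hadj : ContinuousOn (fun x => (matrixR W β x).adjugate) Ω :=
      continuous_id.matrix_adjugate.comp_continuousOn hR
    exact (hdet.inv₀ fun x hx => (matrixR_posDef hβ (hW' x hx)).det_pos.ne').smul hadj
  have hcont : Continuous fun p : (Fin n → ℝ) × Matrix (Fin n) (Fin n) ℝ =>
      p.1 ⬝ᵥ p.2.mulVec p.1 :=
    continuous_fst.dotProduct (continuous_snd.matrix_mulVec continuous_fst)
  refine (hcont.comp_continuousOn ((hgrad hg).prodMk hinv)).congr fun x _ => ?_
  exact dualEnergy_eq W β g x

theorem hasFDerivAt_exp_div {n : ℕ} {Ω : Set (EuclideanSpace ℝ (Fin n))} (hΩ : IsOpen Ω)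
    {W : EuclideanSpace ℝ (Fin n) → ℝ} (hW : ContDiffOn ℝ 2 W Ω) (β : ℝ)
    {z : EuclideanSpace ℝ (Fin n)} (hz : z ∈ Ω) :
    HasFDerivAt (fun x => Real.exp (W x / β)) ((Real.exp (W z / β) / β) • fderiv ℝ W z) z := by
  have := ((((hW.differentiableOn two_ne_zero).differentiableAt
    (hΩ.mem_nhds hz)).hasFDerivAt).mul_const β⁻¹).exp
  simpa only [div_eq_mul_inv, smul_smul] using this

theorem fderiv_fderiv_exp_div {n : ℕ} {Ω : Set (EuclideanSpace ℝ (Fin n))} (hΩ : IsOpen Ω)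
    {W : EuclideanSpace ℝ (Fin n) → ℝ} (hW : ContDiffOn ℝ 2 W Ω) (β : ℝ)
    {z : EuclideanSpace ℝ (Fin n)} (hz : z ∈ Ω) (h : EuclideanSpace ℝ (Fin n)) :
    fderiv ℝ (fderiv ℝ fun x => Real.exp (W x / β)) z h h =
      Real.exp (W z / β) / β * (fderiv ℝ (fderiv ℝ W) z h h + 1 / β * (fderiv ℝ W z h) ^ 2) := by
  have hev : (fderiv ℝ fun x => Real.exp (W x / β)) =ᶠ[𝓝 z]
      fun x => (Real.exp (W x / β) / β) • fderiv ℝ W x := by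
    filter_upwards [hΩ.mem_nhds hz] with x hx
    exact (hasFDerivAt_exp_div hΩ hW β hx).fderiv
  have hd : HasFDerivAt (fun x => Real.exp (W x / β) / β)
      (β⁻¹ • (Real.exp (W z / β) / β) • fderiv ℝ W z) z := by
    simpa only [div_eq_mul_inv] using (hasFDerivAt_exp_div hΩ hW β hz).mul_const β⁻¹
  have h2 := hd.fun_smul (hW.hasFDerivAt_fderiv hΩ hz)
  rw [hev.fderiv_eq, h2.fderiv]
  simp only [_root_.add_apply, _root_.smul_apply, ContinuousLinearMap.smulRight_apply, smul_eq_mul]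
  ring

/-! ### The variance inequality for the matrix `R` on compact convex sets -/

/-- For `V = exp (W / β)`, the squared norm of `(G V)'` dual to `V''` is bounded through Young's
inequality with parameter `s`, since that of `V'` is at most `V`. -/
theorem sq_fderiv_mul_exp_div_le {n : ℕ} {Ω : Set (EuclideanSpace ℝ (Fin n))} (hΩ : IsOpen Ω)
    {W G : EuclideanSpace ℝ (Fin n) → ℝ} (hW : ContDiffOn ℝ 2 W Ω) (hG : ContDiffOn ℝ 1 G Ω)
    {β s : ℝ} (hβ : 0 < β) (hs : 0 < s) {z : EuclideanSpace ℝ (Fin n)} (hz : z ∈ Ω)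
    (hW' : (hessianMatrix W z).PosDef) (h : EuclideanSpace ℝ (Fin n)) :
    (fderiv ℝ (fun x => G x * Real.exp (W x / β)) z h) ^ 2 ≤
      ((1 + 1 / s) * β * dualEnergy W β G z + (1 + s) * G z ^ 2) * Real.exp (W z / β) *
        fderiv ℝ (fderiv ℝ fun x => Real.exp (W x / β)) z h h := by
  have hd := ((hG.differentiableOn one_ne_zero).differentiableAt
    (hΩ.mem_nhds hz)).hasFDerivAt.fun_mul (hasFDerivAt_exp_div hΩ hW β hz)
  rw [hd.fderiv, fderiv_fderiv_exp_div hΩ hW β hz]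
  have hq := sq_fderiv_le_dualEnergy_mul hβ G hW' h
  have hB : 0 ≤ fderiv ℝ (fderiv ℝ W) z h h := by
    rw [← dotProduct_hessianMatrix_mulVec]
    simpa using hW'.posSemidef.dotProduct_mulVec_nonneg h.ofLp
  simp only [_root_.add_apply, _root_.smul_apply, smul_eq_mul]
  set a := fderiv ℝ G z h
  set b := fderiv ℝ W z h
  set v := Real.exp (W z / β)
  set q := dualEnergy W β G z
  set r := fderiv ℝ (fderiv ℝ W) z h h + 1 / β * b ^ 2 with hr
  have hb : (G z * b / β) ^ 2 ≤ G z ^ 2 * r / β := by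
    rw [show (G z * b / β) ^ 2 = G z ^ 2 * (1 / β * b ^ 2) / β by field_simp]
    gcongr
    linarith
  have hyoung : (a + G z * b / β) ^ 2 ≤ (1 + 1 / s) * a ^ 2 + (1 + s) * (G z * b / β) ^ 2 := by
    have h0 : 0 ≤ (a - s * (G z * b / β)) ^ 2 / s := by positivity
    have e : (a - s * (G z * b / β)) ^ 2 / s =
        (1 + 1 / s) * a ^ 2 + (1 + s) * (G z * b / β) ^ 2 - (a + G z * b / β) ^ 2 := by
      generalize G z * b / β = y
      field_simp
      ring
    linarith
  calc (G z * (v / β * b) + v * a) ^ 2 = v ^ 2 * (a + G z * b / β) ^ 2 := by ring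
    _ ≤ v ^ 2 * ((1 + 1 / s) * (q * r) + (1 + s) * (G z ^ 2 * r / β)) := by
        refine mul_le_mul_of_nonneg_left (hyoung.trans ?_) (sq_nonneg v)
        gcongr
    _ = ((1 + 1 / s) * β * q + (1 + s) * G z ^ 2) * v * (v / β * r) := by
        field_simp

/-- The variance inequality for centred functions on a compact convex set. The constant comes from
optimizing Young's inequality in the bound of `(g V)'` by `g'` and `V'`, where `V = exp (W / β)`:
the optimal parameter is `s = √(β + 1) - 1`, for which `β - s = s (s + 1)`. -/
theorem integral_sq_mul_exp_neg_le {n : ℕ} (hn : 1 ≤ n) {β : ℝ} (hβ : (n : ℝ) ≤ β)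
    {Ω K : Set (EuclideanSpace ℝ (Fin n))} (hΩ : IsOpen Ω) (hK : IsCompact K) (hKc : Convex ℝ K)
    (hKΩ : K ⊆ Ω) {W G : EuclideanSpace ℝ (Fin n) → ℝ} (hW : ContDiffOn ℝ 2 W Ω)
    (hW' : ∀ x ∈ Ω, (hessianMatrix W x).PosDef) (hG : ContDiffOn ℝ 1 G Ω)
    (hmean : ∫ x in K, G x * Real.exp (-W x) = 0) :
    ∫ x in K, G x ^ 2 * Real.exp (-W x) ≤ (1 + √(β + 1)) ^ 2 / β *
      ∫ x in K, dualEnergy W β G x * Real.exp (-W x) := by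
  have hβ0 : 0 < β := lt_of_lt_of_le (by exact_mod_cast hn) hβ
  set s := √(β + 1) - 1 with hs
  have hs0 : 0 < s := sub_pos.2 (Real.lt_sqrt_of_sq_lt (by linarith))
  have hβs : β = s * (s + 2) := by
    have := Real.sq_sqrt (show 0 ≤ β + 1 by linarith)
    rw [show √(β + 1) = s + 1 by rw [hs]; ring] at this
    linarith
  have hV : ContDiffOn ℝ 2 (fun x => Real.exp (W x / β)) Ω := (hW.div_const β).exp
  have hq := (continuousOn_dualEnergy hΩ hW hW' hG hβ0).mono hKΩ
  have hGK := hG.continuousOn.mono hKΩ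
  have hWK := hW.continuousOn.mono hKΩ
  have hpow : ∀ x, Real.exp (W x / β) ^ (-β) = Real.exp (-W x) := fun x => by
    rw [← Real.exp_mul]
    congr 1
    field_simp
  have hposV : ∀ z ∈ K, ∀ h ≠ 0,
      0 < fderiv ℝ (fderiv ℝ fun x => Real.exp (W x / β)) z h h := by
    intro z hz h h0
    rw [fderiv_fderiv_exp_div hΩ hW β (hKΩ hz), ← dotProduct_matrixR_mulVec]
    have := (matrixR_posDef hβ0 (hW' z (hKΩ hz))).dotProduct_mulVec_pos (x := h.ofLp) (by simpa)
    rw [star_trivial] at this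
    positivity
  have key := integral_sq_mul_rpow_neg_le hn hβ hΩ hK hKc hKΩ hV hG
    (P := fun x => (1 + 1 / s) * β * dualEnergy W β G x + (1 + s) * G x ^ 2)
    (by fun_prop) (fun x _ => Real.exp_pos _) (fun x hx => ?_) hposV
    (fun z hz h => sq_fderiv_mul_exp_div_le hΩ hW hG hβ0 hs0 (hKΩ hz) (hW' z (hKΩ hz)) h)
    (by simpa only [hpow] using hmean)
  swap
  · have := dualEnergy_nonneg hβ0 G (hW' x (hKΩ hx))
    positivity
  simp only [hpow] at key
  have hE : ContinuousOn (fun x => Real.exp (-W x)) K := by fun_prop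
  have i1 : IntegrableOn (fun x => dualEnergy W β G x * Real.exp (-W x)) K :=
    (hq.mul hE).integrableOn_compact hK
  have i2 : IntegrableOn (fun x => G x ^ 2 * Real.exp (-W x)) K :=
    ((hGK.pow 2).mul hE).integrableOn_compact hK
  simp only [add_mul _ (_ * _ ^ 2), mul_assoc _ _ (Real.exp _)] at key
  rw [integral_add (i1.const_mul _) (i2.const_mul _), integral_const_mul, integral_const_mul] at key
  set J := ∫ x in K, G x ^ 2 * Real.exp (-W x)
  set S := ∫ x in K, dualEnergy W β G x * Real.exp (-W x)
  have h1 : s * (s + 1) * J ≤ (1 + 1 / s) * β * S := by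
    have e : β + 1 - (1 + s) = s * (s + 1) := by rw [hβs]; ring
    rw [← e]
    linarith
  rw [show 1 + √(β + 1) = s + 2 by rw [hs]; ring]
  refine le_of_mul_le_mul_left (a := s * (s + 1)) (h1.trans (le_of_eq ?_)) (by positivity)
  rw [hβs]
  field_simp

theorem setIntegral_gibbsMeasure {n : ℕ} {Ω K : Set (EuclideanSpace ℝ (Fin n))}
    (hK : IsCompact K) (hKΩ : K ⊆ Ω) {W : EuclideanSpace ℝ (Fin n) → ℝ} (hW : ContinuousOn W Ω)
    (f : EuclideanSpace ℝ (Fin n) → ℝ) :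
    ∫ x in K, f x ∂(gibbsMeasure Ω W) = ∫ x in K, f x * Real.exp (-W x) := by
  have hres : (volume.restrict Ω).restrict K = volume.restrict K := by
    rw [Measure.restrict_restrict hK.measurableSet, inter_eq_left.2 hKΩ]
  have hWK := hW.mono hKΩ
  rw [gibbsMeasure, setIntegral_withDensity_eq_setIntegral_toReal_smul₀ _ (by simp) _
    hK.measurableSet, hres]
  · refine setIntegral_congr_fun hK.measurableSet fun x _ => ?_
    simp only [ENNReal.toReal_ofReal (Real.exp_pos _).le, smul_eq_mul, mul_comm]
  · rw [hres]
    exact (ENNReal.continuous_ofReal.comp_continuousOn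
      (by fun_prop : ContinuousOn (fun x => Real.exp (-W x)) K)).aemeasurable hK.measurableSet

theorem dualEnergy_sub_const {n : ℕ} (W : EuclideanSpace ℝ (Fin n) → ℝ) (β : ℝ)
    (g : EuclideanSpace ℝ (Fin n) → ℝ) (c : ℝ) :
    dualEnergy W β (fun x => g x - c) = dualEnergy W β g := by
  ext x
  simp only [dualEnergy, gradient, fderiv_sub_const]

/-- The variance inequality for the restriction of the Gibbs measure to a compact convex set. -/
theorem setIntegral_sq_sub_le {n : ℕ} (hn : 1 ≤ n) {β : ℝ} (hβ : (n : ℝ) ≤ β)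
    {Ω K : Set (EuclideanSpace ℝ (Fin n))} (hΩ : IsOpen Ω) (hK : IsCompact K) (hKc : Convex ℝ K)
    (hKΩ : K ⊆ Ω) {W g : EuclideanSpace ℝ (Fin n) → ℝ} (hW : ContDiffOn ℝ 2 W Ω)
    (hW' : ∀ x ∈ Ω, (hessianMatrix W x).PosDef) (hg : ContDiffOn ℝ 1 g Ω)
    (hK0 : ∫ _ in K, (1 : ℝ) ∂(gibbsMeasure Ω W) ≠ 0) :
    (∫ x in K, g x ^ 2 ∂(gibbsMeasure Ω W)) -
        (∫ x in K, g x ∂(gibbsMeasure Ω W)) ^ 2 / ∫ _ in K, (1 : ℝ) ∂(gibbsMeasure Ω W) ≤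
      (1 + √(β + 1)) ^ 2 / β * ∫ x in K, dualEnergy W β g x ∂(gibbsMeasure Ω W) := by
  simp only [setIntegral_gibbsMeasure hK hKΩ hW.continuousOn, one_mul] at hK0 ⊢
  set m := ∫ x in K, Real.exp (-W x) with hm
  set a := ∫ x in K, g x * Real.exp (-W x) with ha
  have hgK := hg.continuousOn.mono hKΩ
  have hWK := hW.continuousOn.mono hKΩ
  have i0 : IntegrableOn (fun x => Real.exp (-W x)) K :=
    ContinuousOn.integrableOn_compact hK (by fun_prop)
  have i1 : IntegrableOn (fun x => g x * Real.exp (-W x)) K :=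
    ContinuousOn.integrableOn_compact hK (by fun_prop)
  have i2 : IntegrableOn (fun x => g x ^ 2 * Real.exp (-W x)) K :=
    ContinuousOn.integrableOn_compact hK (by fun_prop)
  have key := integral_sq_mul_exp_neg_le hn hβ hΩ hK hKc hKΩ hW hW'
    (G := fun x => g x - a / m) (hg.sub contDiffOn_const) ?_
  · rw [dualEnergy_sub_const] at key
    refine le_trans (le_of_eq ?_) key
    have e : ∀ x, (g x - a / m) ^ 2 * Real.exp (-W x) = g x ^ 2 * Real.exp (-W x) -
        (2 * (a / m) * (g x * Real.exp (-W x)) - (a / m) ^ 2 * Real.exp (-W x)) := fun x => by ring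
    simp only [e]
    have i3 : IntegrableOn (fun x => 2 * (a / m) * (g x * Real.exp (-W x)) -
      (a / m) ^ 2 * Real.exp (-W x)) K := (i1.const_mul _).sub (i0.const_mul _)
    rw [integral_sub i2 i3, integral_sub (i1.const_mul _) (i0.const_mul _), integral_const_mul,
      integral_const_mul, ← ha, ← hm]
    field_simp
    ring
  · simp only [sub_mul]
    rw [integral_sub i1 (i0.const_mul _), integral_const_mul, ← ha, ← hm]
    field_simp
    ring

/-! ### Exhaustion of the domain -/

/-- The points of norm at most `k` at distance at least `1/(k+1)` from the complement of `Ω`. -/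
def convexExhaustion {E : Type*} [NormedAddCommGroup E] (Ω : Set E) (k : ℕ) : Set E :=
  Metric.closedBall 0 (k : ℝ) ∩ {x | ∀ y ∉ Ω, 1 / ((k : ℝ) + 1) ≤ ‖y - x‖}

section Exhaustion

variable {E : Type*} [NormedAddCommGroup E] {Ω : Set E}

theorem convexExhaustion_subset (k : ℕ) : convexExhaustion Ω k ⊆ Ω := by
  intro x hx
  by_contra hxΩ
  have := hx.2 x hxΩ
  rw [sub_self, norm_zero] at this
  exact absurd this (not_le.2 (by positivity))

theorem isCompact_convexExhaustion [ProperSpace E] (k : ℕ) :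
    IsCompact (convexExhaustion Ω k) := by
  refine (isCompact_closedBall 0 _).inter_right ?_
  simp only [ofPred_forall]
  exact isClosed_biInter fun y _ => isClosed_le continuous_const (by fun_prop)

theorem convex_convexExhaustion [NormedSpace ℝ E] (hΩ : Convex ℝ Ω) (k : ℕ) :
    Convex ℝ (convexExhaustion Ω k) := by
  refine (convex_closedBall 0 _).inter ?_
  intro x hx x' hx' a b ha hb hab y hy
  by_contra! hlt
  set d := y - (a • x + b • x') with hd
  have hmem : ∀ w, (∀ y ∉ Ω, 1 / ((k : ℝ) + 1) ≤ ‖y - w‖) → w + d ∈ Ω := by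
    intro w hw
    by_contra hwΩ
    have := hw _ hwΩ
    rw [add_sub_cancel_left] at this
    linarith
  refine hy ?_
  have e : y = a • (x + d) + b • (x' + d) := by
    calc y = (a • x + b • x') + (1 : ℝ) • d := by rw [hd, one_smul]; abel
      _ = a • (x + d) + b • (x' + d) := by rw [← hab]; module
  rw [e]
  exact hΩ (hmem x hx) (hmem x' hx') ha hb hab

theorem monotone_convexExhaustion : Monotone (convexExhaustion Ω) := by
  intro k l hkl
  refine inter_subset_inter (Metric.closedBall_subset_closedBall (by exact_mod_cast hkl)) ?_
  intro x hx y hy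
  refine le_trans ?_ (hx y hy)
  gcongr

theorem iUnion_convexExhaustion (hΩ : IsOpen Ω) : ⋃ k, convexExhaustion Ω k = Ω := by
  refine Subset.antisymm (iUnion_subset convexExhaustion_subset) fun x hx => ?_
  obtain ⟨ε, hε, hball⟩ := Metric.isOpen_iff.1 hΩ x hx
  obtain ⟨k, hk⟩ := exists_nat_one_div_lt hε
  obtain ⟨l, hl⟩ := exists_nat_ge ‖x‖
  refine mem_iUnion.2 ⟨max k l, ?_, fun y hy => ?_⟩
  · rw [mem_closedBall_zero_iff]
    exact hl.trans (by exact_mod_cast le_max_right k l)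
  · have h1 : ε ≤ ‖y - x‖ := by
      by_contra! hlt
      exact hy (hball (by rwa [Metric.mem_ball, dist_eq_norm]))
    refine le_trans ?_ (hk.le.trans h1)
    gcongr
    exact le_max_left _ _

end Exhaustion

/-- The right-hand side may be `+∞`, so the inequality is stated in `[0, ∞]`. -/
theorem theorem2p4 {n : ℕ} (hn : 1 ≤ n) (Ω : Set (EuclideanSpace ℝ (Fin n)))
    (hΩ : IsOpen Ω) (hΩc : Convex ℝ Ω)
    (W : EuclideanSpace ℝ (Fin n) → ℝ) (hW : ContDiffOn ℝ 2 W Ω)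
    (hW' : ∀ x ∈ Ω, (hessianMatrix W x).PosDef)
    (hμ : MeasureTheory.IsProbabilityMeasure (gibbsMeasure Ω W))
    (g : EuclideanSpace ℝ (Fin n) → ℝ) (hg : ContDiffOn ℝ ∞ g Ω)
    (hg2 : MeasureTheory.MemLp g 2 (gibbsMeasure Ω W))
    (β : ℝ) (hβ : (n : ℝ) ≤ β) :
    ENNReal.ofReal (ProbabilityTheory.variance g (gibbsMeasure Ω W)) ≤
      ENNReal.ofReal ((1 + Real.sqrt (β + 1)) ^ 2 / β) *
        ∫⁻ x, ENNReal.ofReal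
          (inner ℝ (Matrix.toEuclideanLin (matrixR W β x)⁻¹ (gradient g x)) (gradient g x))
          ∂(gibbsMeasure Ω W) := by
  have hβ0 : 0 < β := lt_of_lt_of_le (by exact_mod_cast hn) hβ
  set μ := gibbsMeasure Ω W with hμdef
  change _ ≤ _ * ∫⁻ x, ENNReal.ofReal (dualEnergy W β g x) ∂μ
  set C := (1 + √(β + 1)) ^ 2 / β with hC
  have hC0 : 0 < C := by positivity
  set X := ∫⁻ x, ENNReal.ofReal (dualEnergy W β g x) ∂μ with hX
  rcases eq_or_ne X ⊤ with hXtop | hXtop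
  · rw [hXtop, ENNReal.mul_top (by simpa using hC0)]
    exact le_top
  have hg1 : ContDiffOn ℝ 1 g Ω := hg.of_le (by exact_mod_cast le_top)
  have hq := continuousOn_dualEnergy hΩ hW hW' hg1 hβ0
  set K := convexExhaustion Ω with hKdef
  have hKc : ∀ k, IsCompact (K k) := isCompact_convexExhaustion
  have hKm : ∀ k, MeasurableSet (K k) := fun k => (hKc k).measurableSet
  have hres : μ.restrict Ω = μ := by
    rw [hμdef, gibbsMeasure, restrict_withDensity hΩ.measurableSet,
      Measure.restrict_restrict hΩ.measurableSet, inter_self]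
  have hlim : ∀ {f : EuclideanSpace ℝ (Fin n) → ℝ}, Integrable f μ →
      Tendsto (fun k => ∫ x in K k, f x ∂μ) atTop (𝓝 (∫ x, f x ∂μ)) := by
    intro f hf
    have := tendsto_setIntegral_of_monotone hKm monotone_convexExhaustion
      (hf.integrableOn (s := ⋃ k, K k))
    rwa [hKdef, iUnion_convexExhaustion hΩ, hres] at this
  have hone := hlim (integrable_const (1 : ℝ))
  rw [integral_const, probReal_univ, one_smul] at hone
  have hbound : ∀ k, ∫ x in K k, dualEnergy W β g x ∂μ ≤ X.toReal := by
    intro k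
    have hnonneg : ∀ x ∈ K k, 0 ≤ dualEnergy W β g x := fun x hx =>
      dualEnergy_nonneg hβ0 g (hW' x (convexExhaustion_subset k hx))
    rw [integral_eq_lintegral_of_nonneg_ae
      ((ae_restrict_iff' (hKm k)).2 (ae_of_all _ hnonneg))
      ((hq.mono (convexExhaustion_subset k)).aestronglyMeasurable (hKm k))]
    exact ENNReal.toReal_mono hXtop (setLIntegral_le_lintegral _ _)
  have hvar : ProbabilityTheory.variance g μ ≤ C * X.toReal := by
    rw [ProbabilityTheory.variance_eq_sub hg2]
    have hL := (hlim hg2.integrable_sq).sub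
      (((hlim (hg2.integrable one_le_two)).pow 2).div hone one_ne_zero)
    rw [div_one] at hL
    refine le_of_tendsto hL ?_
    -- the mean over `K k` makes sense once `K k` has positive measure
    filter_upwards [hone.eventually_ne one_ne_zero] with k hk
    exact (setIntegral_sq_sub_le hn hβ hΩ (hKc k) (convex_convexExhaustion hΩc k)
      (convexExhaustion_subset k) hW hW' hg1 hk).trans
        (mul_le_mul_of_nonneg_left (hbound k) hC0.le)
  calc ENNReal.ofReal (ProbabilityTheory.variance g μ) ≤ ENNReal.ofReal (C * X.toReal) :=
        ENNReal.ofReal_le_ofReal hvar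
    _ = ENNReal.ofReal C * X := by
        rw [ENNReal.ofReal_mul hC0.le, ENNReal.ofReal_toReal hXtop]
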